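/- Let $N\ge 2$ be an integer, $R>0$, $\mu\ge 0$, $V(x)=\mu/\sqrt{1+|x|^2}$ for $x\in\mathbb{R}^N$, let $p_G(n)=1+\frac{2}{n-1}$, and let $1<p\le p_G(N+\mu)$. For $\varepsilon>0$, $f\in H^1(\mathbb{R}^N)$ and $g\in L^2(\mathbb{R}^N)$ (real valued) consider the problem $$\partial_t^2u-\Delta u+V(x)\,\partial_tu=|\partial_tu|^p,\qquad u(\cdot,0)=\varepsilon f,\quad \partial_tu(\cdot,0)=\varepsilon g. \tag{1}$$ For $T\in(0,\infty]$, an *energy solution* of (1) on $[0,T)$ is a function $u\in C([0,T),H^1(\mathbb{R}^N))\cap C^1([0,T),L^2(\mathbb{R}^N))$ with $\partial_tu\in L^p_{loc}((0,T)\times\mathbb{R}^N)$ and $u(\cdot,0)=\varepsilon f$ such that, for every function $\varphi$ that is $C^1$ with compact support in $[0,T)\times\mathbb{R}^N$ and $C^\infty$ in $(0,T)\times\mathbb{R}^N$, the function $|\partial_tu|^p\varphi$ is integrable on $(0,T)\times\mathbb{R}^N$ and $$\varepsilon\int_{\mathbb{R}^N}g\,\varphi(x,0)\,dx+\int_0^T\!\!\int_{\mathbb{R}^N}|\partial_tu|^p\varphi\,dxdt=-\int_0^T\!\!\int_{\mathbb{R}^N}\partial_tu\,\partial_t\varphi\,dxdt+\int_0^T\!\!\int_{\mathbb{R}^N}\nabla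 u\cdot\nabla\varphi\,dxdt+\int_0^T\!\!\int_{\mathbb{R}^N}V\,\partial_tu\,\varphi\,dxdt.$$ The lifespan $T_\varepsilon=T_\varepsilon(f,g)$ is the supremum of all $T\in(0,\infty]$ for which there is a unique energy solution of (1) on $[0,T)$. An energy solution $u$ on $[0,T)$ is said to be *supported in the cone* if $\operatorname{supp}u\subset\{(x,t)\in\mathbb{R}^N\times[0,T):|x|\le R+t\}$. **Theorem.** Let $\phi\in C^2(\mathbb{R}^N)$ be a positive solution of $\Delta\phi=(1+V)\phi$ on $\mathbb{R}^N$. Let $f\in H^1(\mathbb{R}^N)$ and $g\in L^2(\mathbb{R}^N)$ be supported in the ball $\{|x|\le R\}$ and satisfy $$\int_{\mathbb{R}^N}\big(\Delta f(x)+g(x)\big)\phi(x)\,dx>0,$$ where $\Delta f$ is understood as a distribution, that is, $\int(\Delta f)\phi=\int f\,\Delta\phi$. Then: 1. For every $\varepsilon>0$, problem (1) has no energy solution on $[0,\infty)$ that is supported in the cone. 2. There are constants $\varepsilon_0>0$ and $C>0$, both independent of $\varepsilon$, such that for every $0<\varepsilon\le\varepsilon_0$ and every $T\in(0,\infty]$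 for which (1) has an energy solution on $[0,T)$ supported in the cone, $$T\le\begin{cases}C\,\varepsilon^{-\frac{2(p-1)}{2-(N+\mu-1)(p-1)}}&\text{if }1<p<p_G(N+\mu),\\[2mm]\exp\!\big(C\varepsilon^{-(p-1)}\big)&\text{if }p=p_G(N+\mu).\end{cases}$$ In particular, if the energy solution on $[0,T_\varepsilon)$ exists and is supported in the cone, then the lifespan $T_\varepsilon$ satisfies this bound. -/

import Mathlib

open MeasureTheory Set Filter Topology
open scoped ENNReal ContDiff Gradient Laplacian

namespace DampedWave

/-- The space `ℝ^N` with its Euclidean norm. -/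
abbrev Space (N : ℕ) : Type := EuclideanSpace ℝ (Fin N)

/-- `L²(ℝ^N)`, real valued. -/
abbrev L2 (N : ℕ) : Type := Lp ℝ 2 (volume : Measure (Space N))

/-- `L²(ℝ^N)`, with values in `ℝ^N`. -/
abbrev L2vec (N : ℕ) : Type := Lp (Space N) 2 (volume : Measure (Space N))

/-- `W` is the weak gradient of `w`: for all test functions `χ ∈ C_c^∞(ℝ^N)` and directions `e`,
`∫ w ∂_e χ = - ∫ χ (W · e)`. -/
def IsWeakGradient {N : ℕ} (w : L2 N) (W : L2vec N) : Prop :=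
  ∀ χ : Space N → ℝ, ContDiff ℝ ∞ χ → HasCompactSupport χ → ∀ e : Space N,
    ∫ x, w x * fderiv ℝ χ x e = - ∫ x, χ x * inner ℝ (W x) e

theorem integrable_L2_mul {N : ℕ} (w : L2 N) {χ : Space N → ℝ} (hχ : Continuous χ)
    (hc : HasCompactSupport χ) : Integrable (fun x => w x * χ x) :=
  have h : MemLp χ 2 (volume : Measure (Space N)) := hχ.memLp_of_hasCompactSupport hc
  (Lp.memLp w).integrable_mul h

theorem integrable_mul_inner_L2vec {N : ℕ} (W : L2vec N) {χ : Space N → ℝ} (hχ : Continuous χ)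
    (hc : HasCompactSupport χ) (e : Space N) :
    Integrable (fun x => χ x * inner ℝ (W x) e) := by
  have h1 : MemLp χ 2 (volume : Measure (Space N)) := hχ.memLp_of_hasCompactSupport hc
  have h2 : MemLp (fun x => inner ℝ (W x) e) 2 (volume : Measure (Space N)) :=
    (Lp.memLp W).inner_const e
  exact h1.integrable_mul h2

/-- The Sobolev space `H¹(ℝ^N)`, as the space of pairs `(w, ∇w)` in `L² × L²` with `∇w` the weak
gradient of `w`. The weak gradient is determined by `w`, and the norm inherited from the product is
equivalent to the usual `H¹` norm, so this is `H¹(ℝ^N)` with its topology. -/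
def H1 (N : ℕ) : Submodule ℝ (L2 N × L2vec N) where
  carrier := {z | IsWeakGradient z.1 z.2}
  zero_mem' := by
    intro χ hχ hc e
    have h1 : ∫ x, ((0 : L2 N) : Space N → ℝ) x * fderiv ℝ χ x e = 0 := by
      refine integral_eq_zero_of_ae ?_
      filter_upwards [Lp.coeFn_zero ℝ 2 (volume : Measure (Space N))] with x hx
      rw [hx]
      simp
    have h2 : ∫ x, χ x * inner ℝ (((0 : L2vec N) : Space N → Space N) x) e = 0 := by
      refine integral_eq_zero_of_ae ?_
      filter_upwards [Lp.coeFn_zero (Space N) 2 (volume : Measure (Space N))] with x hx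
      rw [hx]
      simp
    change ∫ x, ((0 : L2 N) : Space N → ℝ) x * fderiv ℝ χ x e =
      - ∫ x, χ x * inner ℝ (((0 : L2vec N) : Space N → Space N) x) e
    rw [h1, h2, neg_zero]
  add_mem' := by
    intro a b ha hb χ hχ hc e
    have hd : Continuous (fun x => fderiv ℝ χ x e) :=
      (hχ.continuous_fderiv (by simp)).clm_apply continuous_const
    have hdc : HasCompactSupport (fun x => fderiv ℝ χ x e) := hc.fderiv_apply (𝕜 := ℝ) e
    have h1 : ∫ x, ((a.1 + b.1 : L2 N) : Space N → ℝ) x * fderiv ℝ χ x e =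
        (∫ x, a.1 x * fderiv ℝ χ x e) + ∫ x, b.1 x * fderiv ℝ χ x e := by
      rw [← integral_add (integrable_L2_mul a.1 hd hdc) (integrable_L2_mul b.1 hd hdc)]
      refine integral_congr_ae ?_
      filter_upwards [Lp.coeFn_add a.1 b.1] with x hx
      rw [hx, Pi.add_apply, add_mul]
    have h2 : ∫ x, χ x * inner ℝ (((a.2 + b.2 : L2vec N) : Space N → Space N) x) e =
        (∫ x, χ x * inner ℝ (a.2 x) e) + ∫ x, χ x * inner ℝ (b.2 x) e := by
      rw [← integral_add (integrable_mul_inner_L2vec a.2 hχ.continuous hc e)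
        (integrable_mul_inner_L2vec b.2 hχ.continuous hc e)]
      refine integral_congr_ae ?_
      filter_upwards [Lp.coeFn_add a.2 b.2] with x hx
      rw [hx, Pi.add_apply, inner_add_left, mul_add]
    change ∫ x, ((a.1 + b.1 : L2 N) : Space N → ℝ) x * fderiv ℝ χ x e =
      - ∫ x, χ x * inner ℝ (((a.2 + b.2 : L2vec N) : Space N → Space N) x) e
    rw [h1, h2, ha χ hχ hc e, hb χ hχ hc e]
    ring
  smul_mem' := by
    intro c a ha χ hχ hc e
    have h1 : ∫ x, ((c • a.1 : L2 N) : Space N → ℝ) x * fderiv ℝ χ x e =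
        c * ∫ x, a.1 x * fderiv ℝ χ x e := by
      rw [← integral_const_mul]
      refine integral_congr_ae ?_
      filter_upwards [Lp.coeFn_smul c a.1] with x hx
      rw [hx, Pi.smul_apply, smul_eq_mul, mul_assoc]
    have h2 : ∫ x, χ x * inner ℝ (((c • a.2 : L2vec N) : Space N → Space N) x) e =
        c * ∫ x, χ x * inner ℝ (a.2 x) e := by
      rw [← integral_const_mul]
      refine integral_congr_ae ?_
      filter_upwards [Lp.coeFn_smul c a.2] with x hx
      rw [hx, Pi.smul_apply, real_inner_smul_left]
      ring
    change ∫ x, ((c • a.1 : L2 N) : Space N → ℝ) x * fderiv ℝ χ x e =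
      - ∫ x, χ x * inner ℝ (((c • a.2 : L2vec N) : Space N → Space N) x) e
    rw [h1, h2, ha χ hχ hc e]
    ring

/-- The underlying `L²` function of an element of `H¹`. -/
def fn {N : ℕ} (w : H1 N) : L2 N := w.1.1

/-- The weak gradient of an element of `H¹`. -/
def grad {N : ℕ} (w : H1 N) : L2vec N := w.1.2

/-- The damping coefficient `V(x) = μ / √(1 + |x|²)`. -/
noncomputable def damping {N : ℕ} (μ : ℝ) (x : Space N) : ℝ := μ / √(1 + ‖x‖ ^ 2)

/-- The Glassey exponent `p_G(n) = 1 + 2 / (n - 1)`, for a real parameter `n > 1`. -/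
noncomputable def glasseyExponent (n : ℝ) : ℝ := 1 + 2 / (n - 1)

/-- The time interval `[0, T)`, where `T ∈ [0, ∞]`. -/
def timeIco (T : ℝ≥0∞) : Set ℝ := {t | 0 ≤ t ∧ ENNReal.ofReal t < T}

/-- The time interval `(0, T)`, where `T ∈ [0, ∞]`. -/
def timeIoo (T : ℝ≥0∞) : Set ℝ := {t | 0 < t ∧ ENNReal.ofReal t < T}

/-- Test functions: `C¹` on `[0, T) × ℝ^N` with compact support in `[0, T) × ℝ^N`, and `C^∞` on
`(0, T) × ℝ^N`. -/
structure IsTestFunction (N : ℕ) (T : ℝ≥0∞) (χ : ℝ × Space N → ℝ) : Prop where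
  contDiffOn_one : ContDiffOn ℝ 1 χ (timeIco T ×ˢ univ)
  contDiffOn_infty : ContDiffOn ℝ ∞ χ (timeIoo T ×ˢ univ)
  compact_support : ∃ K : Set (ℝ × Space N), IsCompact K ∧ K ⊆ timeIco T ×ˢ univ ∧
    ∀ z ∈ timeIco T ×ˢ univ, z ∉ K → χ z = 0

/-- `u` is an energy solution on `[0, T)` of
`∂ₜ²u - Δu + V(x) ∂ₜu = |∂ₜu|^p`, `u(0) = ε f`, `∂ₜu(0) = ε g`; the function `v` is `∂ₜu`.
Only the values of `u` on `[0, T)` matter. All integrals over space-time are iterated ones, which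
do not depend on the choice of representatives of `v t` and `grad (u t)`. -/
def IsEnergySolution {N : ℕ} (μ p ε : ℝ) (f : H1 N) (g : L2 N) (T : ℝ≥0∞) (u : ℝ → H1 N) : Prop :=
  0 < T ∧ ContinuousOn u (timeIco T) ∧ u 0 = ε • f ∧
  ∃ v : ℝ → L2 N,
    (∀ t ∈ timeIco T, HasDerivWithinAt (fun s => fn (u s)) (v t) (timeIco T) t) ∧
    ContinuousOn v (timeIco T) ∧
    -- `∂ₜu ∈ L^p_loc((0, T) × ℝ^N)`
    (∀ a b r : ℝ, 0 < a → b ∈ timeIco T →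
      ∫⁻ t in Icc a b, ∫⁻ x in Metric.closedBall (0 : Space N) r, ‖v t x‖ₑ ^ p < ⊤) ∧
    ∀ χ : ℝ × Space N → ℝ, IsTestFunction N T χ →
      -- the nonlinear term of the identity is an absolutely convergent integral
      (∫⁻ t in timeIoo T, ∫⁻ x, ‖|v t x| ^ p * χ (t, x)‖ₑ < ⊤) ∧
      ε * (∫ x, g x * χ (0, x)) + ∫ t in timeIoo T, ∫ x, |v t x| ^ p * χ (t, x) =
        (∫ t in timeIoo T, ∫ x, - (v t x * deriv (fun s => χ (s, x)) t)) +
        (∫ t in timeIoo T, ∫ x, inner ℝ (grad (u t) x) (∇ (fun y => χ (t, y)) x)) +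
        ∫ t in timeIoo T, ∫ x, damping μ x * v t x * χ (t, x)

/-- The support of `u` on `[0, T)` is contained in the cone `|x| ≤ R + t`. -/
def SupportedInCone {N : ℕ} (R : ℝ) (T : ℝ≥0∞) (u : ℝ → H1 N) : Prop :=
  ∀ t ∈ timeIco T, ∀ᵐ x : Space N, R + t < ‖x‖ → fn (u t) x = 0

/-- The lifespan `T_ε(f, g)`: the supremum of all `T ∈ (0, ∞]` such that there is a unique energy
solution on `[0, T)`. -/
noncomputable def lifespan {N : ℕ} (μ p ε : ℝ) (f : H1 N) (g : L2 N) : ℝ≥0∞ :=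
  sSup {T | (∃ u, IsEnergySolution μ p ε f g T u) ∧
    ∀ u₁ u₂, IsEnergySolution μ p ε f g T u₁ → IsEnergySolution μ p ε f g T u₂ →
      EqOn u₁ u₂ (timeIco T)}

/-- The pairing `∫ (Δf + g) φ` for `f, g ∈ L²` with compact support and `φ ∈ C²`, where `Δf` is the
distributional Laplacian, `⟨Δf, φ⟩ = ∫ f Δφ`. -/
noncomputable def dataPairing {N : ℕ} (f g : L2 N) (φ : Space N → ℝ) : ℝ :=
  (∫ x, f x * Δ φ x) + ∫ x, g x * φ x

/-- The upper bound of the lifespan: `C ε^{-2(p-1)/(2-(N+μ-1)(p-1))}` if `p < p_G(N+μ)`, and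
`exp(C ε^{-(p-1)})` if `p = p_G(N+μ)`. -/
noncomputable def lifespanBound (N : ℕ) (μ p C ε : ℝ) : ℝ :=
  if p < glasseyExponent (N + μ) then
    C * ε ^ (-(2 * (p - 1) / (2 - (N + μ - 1) * (p - 1))))
  else Real.exp (C * ε ^ (-(p - 1)))

end DampedWave

open DampedWave

namespace DampedWave

/-! Because Δφ = (1 + V)φ, the function e^{-t}φ(x) solves the adjoint linear equation ψ_tt - Δψ -
Vψ_t = 0. Test the weak formulation with η(t)e^{-t}φ(x), where η decreases from 1 at t = 0 to 0 at t
= T' < T. Put k = ηe^{-t}, and let K be the primitive of -k that vanishes at T'. Integrating the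
term in u by parts in time leaves only ∂ₜu: ε(∫gφ + K(0)∫fΔφ) + ∬|∂ₜu|^p kφ = ∬ ∂ₜu (-η' + (1 +
V)e^tΘ) e^{-t}φ, with Θ(t) = ∫_t^{T'} -η'(s)e^{-s} ds and K(0) = 1 - Θ(0). If the factor in
parentheses is at most bη^{1/p}, Young's inequality absorbs ∂ₜu into the nonlinear term. The support
in the cone then leaves on the right only ∫ b^q e^{-t} ∫_{|x|≤R+t} φ dx dt
(`energy_inequality_of_test`; `energy_inequality` removes the smooth approximation of φ).

The second ingredient is the growth of φ: its mass in the ball of radius r is O(e^r(1+r)^a) with a =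
(N-1+μ)/2 (`exists_mass_bound`). No symmetry or asymptotics of φ are assumed. The bound is obtained
by duality, pairing φ with a compactly supported truncation of a radial subsolution that behaves
like e^{-|x|}|x|^{-a}.

For cutoffs η = ζ∘τ with 0 ≤ τ' ≤ w, w decreasing and w(0) small, the two ingredients give ε ≤
C∫_0^{T'} w^q(1+t)^a dt (`exists_weighted_inequality`), q being the conjugate exponent of p. For p <
p_G(N+μ) one has a < q-1, and the linear scale τ = t/T' yields ε ≤ C T'^{a-(q-1)}. For p = p_G(N+μ)
one has a = q-1, and a logarithmic scale yields a negative power of log T' instead. Every T' < T is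
thus bounded in terms of ε, which excludes global solutions and gives the lifespan bound. -/

/-! ### The Laplacian in coordinates and Green's identity. -/

/-- The `i`-th standard basis vector of `ℝ^N`. -/
noncomputable abbrev stdVec {N : ℕ} (i : Fin N) : Space N := EuclideanSpace.single i (1 : ℝ)

theorem laplacian_eq_sum_fderiv {N : ℕ} {f : Space N → ℝ} (hf : ContDiff ℝ 2 f) (x : Space N) :
    Δ f x = ∑ i, fderiv ℝ (fun y => fderiv ℝ f y (stdVec i)) x (stdVec i) := by
  rw [InnerProductSpace.laplacian_eq_iteratedFDeriv_orthonormalBasis f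
    (EuclideanSpace.basisFun (Fin N) ℝ)]
  refine Finset.sum_congr rfl fun i _ => ?_
  have hd : DifferentiableAt ℝ (fderiv ℝ f) x :=
    ((hf.fderiv_right (m := 1) (by norm_num)).differentiable (by norm_num)).differentiableAt
  rw [iteratedFDeriv_two_apply, fderiv_clm_apply hd (differentiableAt_const _)]
  simp

theorem contDiff_fderiv_apply {N : ℕ} {n m : WithTop ℕ∞} {f : Space N → ℝ} (hf : ContDiff ℝ n f)
    (h : m + 1 ≤ n) (e : Space N) : ContDiff ℝ m (fun y => fderiv ℝ f y e) :=
  (hf.fderiv_right h).clm_apply contDiff_const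

theorem continuous_laplacian {N : ℕ} {f : Space N → ℝ} (hf : ContDiff ℝ 2 f) :
    Continuous (Δ f) := by
  have : Δ f = fun x => ∑ i, fderiv ℝ (fun y => fderiv ℝ f y (stdVec i)) x (stdVec i) :=
    funext fun x => laplacian_eq_sum_fderiv hf x
  rw [this]
  refine continuous_finsetSum _ fun i _ => ?_
  exact (contDiff_fderiv_apply (n := 1) (m := 0)
    (contDiff_fderiv_apply (n := 2) (m := 1) hf (by norm_num) _) (by norm_num) _).continuous

theorem hasCompactSupport_laplacian {N : ℕ} {f : Space N → ℝ}
    (hc : HasCompactSupport f) : HasCompactSupport (Δ f) := by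
  refine HasCompactSupport.intro hc fun x hx => ?_
  have h0 : f =ᶠ[𝓝 x] fun _ => (0 : ℝ) := notMem_tsupport_iff_eventuallyEq.1 hx
  rw [(InnerProductSpace.laplacian_congr_nhds h0).eq_of_nhds]
  simp

theorem integral_mul_fderiv_comm {N : ℕ} {f h : Space N → ℝ} (hf : ContDiff ℝ 1 f)
    (hh : ContDiff ℝ 1 h) (hc : HasCompactSupport h) (e : Space N) :
    ∫ x, f x * fderiv ℝ h x e = - ∫ x, fderiv ℝ f x e * h x := by
  have c1 : Continuous fun x => fderiv ℝ f x e :=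
    (contDiff_fderiv_apply (m := 0) hf (by norm_num) e).continuous
  have c2 : Continuous fun x => fderiv ℝ h x e :=
    (contDiff_fderiv_apply (m := 0) hh (by norm_num) e).continuous
  refine integral_mul_fderiv_eq_neg_fderiv_mul_of_integrable ?_ ?_ ?_
    (fun x _ => hf.differentiable (by norm_num) x) (fun x _ => hh.differentiable (by norm_num) x)
  · exact (c1.mul hh.continuous).integrable_of_hasCompactSupport hc.mul_left
  · exact (hf.continuous.mul c2).integrable_of_hasCompactSupport
      (hc.fderiv_apply (𝕜 := ℝ) e).mul_left
  · exact (hf.continuous.mul hh.continuous).integrable_of_hasCompactSupport hc.mul_left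

/-- Green's second identity, one factor being compactly supported. -/
theorem integral_mul_laplacian_comm {N : ℕ} {f h : Space N → ℝ} (hf : ContDiff ℝ 2 f)
    (hh : ContDiff ℝ 2 h) (hc : HasCompactSupport h) :
    ∫ x, f x * Δ h x = ∫ x, Δ f x * h x := by
  simp_rw [laplacian_eq_sum_fderiv hf, laplacian_eq_sum_fderiv hh, Finset.mul_sum, Finset.sum_mul]
  have d1 : ∀ {k : Space N → ℝ}, ContDiff ℝ 2 k → ∀ i : Fin N,
      ContDiff ℝ 1 fun y => fderiv ℝ k y (stdVec i) :=
    fun hk i => contDiff_fderiv_apply hk (by norm_num) _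
  have d2 : ∀ {k : Space N → ℝ}, ContDiff ℝ 2 k → ∀ i : Fin N,
      Continuous fun x => fderiv ℝ (fun y => fderiv ℝ k y (stdVec i)) x (stdVec i) :=
    fun hk i => (contDiff_fderiv_apply (m := 0) (d1 hk i) (by norm_num) _).continuous
  have hc1 : ∀ i : Fin N, HasCompactSupport fun y => fderiv ℝ h y (stdVec i) :=
    fun i => hc.fderiv_apply (𝕜 := ℝ) _
  rw [integral_finsetSum, integral_finsetSum]
  · refine Finset.sum_congr rfl fun i _ => ?_
    rw [integral_mul_fderiv_comm (hf.of_le (by norm_num)) (d1 hh i) (hc1 i),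
      integral_mul_fderiv_comm (d1 hf i) (hh.of_le (by norm_num)) hc, neg_neg]
  · exact fun i _ => ((d2 hf i).mul hh.continuous).integrable_of_hasCompactSupport hc.mul_left
  · exact fun i _ => (hf.continuous.mul (d2 hh i)).integrable_of_hasCompactSupport
      ((hc1 i).fderiv_apply (𝕜 := ℝ) _).mul_left

/-! ### Radial functions of the Japanese bracket. -/

/-- The Japanese bracket `⟨x⟩ = √(1 + |x|²)`. -/
noncomputable def bracket {N : ℕ} (x : Space N) : ℝ := √(1 + ‖x‖ ^ 2)

theorem bracket_sq {N : ℕ} (x : Space N) : bracket x ^ 2 = 1 + ‖x‖ ^ 2 :=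
  Real.sq_sqrt (by positivity)

theorem one_le_bracket {N : ℕ} (x : Space N) : 1 ≤ bracket x := by
  rw [bracket, Real.one_le_sqrt]
  nlinarith [sq_nonneg ‖x‖]

theorem bracket_pos {N : ℕ} (x : Space N) : 0 < bracket x := one_pos.trans_le (one_le_bracket x)

theorem norm_le_bracket {N : ℕ} (x : Space N) : ‖x‖ ≤ bracket x :=
  Real.le_sqrt_of_sq_le (by linarith)

theorem bracket_le {N : ℕ} (x : Space N) : bracket x ≤ 1 + ‖x‖ := by
  rw [bracket, Real.sqrt_le_left (by positivity)]
  nlinarith [norm_nonneg x]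

theorem contDiff_bracket {N : ℕ} {n : WithTop ℕ∞} : ContDiff ℝ n (bracket : Space N → ℝ) :=
  (contDiff_const.add (contDiff_norm_sq ℝ)).sqrt fun x => by positivity

theorem hasFDerivAt_bracket {N : ℕ} (x : Space N) :
    HasFDerivAt bracket ((bracket x)⁻¹ • innerSL ℝ x) x := by
  have h1 : HasFDerivAt (fun y : Space N => 1 + ‖y‖ ^ 2) (2 • innerSL ℝ x) x :=
    (hasStrictFDerivAt_norm_sq x).hasFDerivAt.const_add 1
  have h2 := h1.sqrt (by positivity)
  refine h2.congr_fderiv ?_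
  change (1 / (2 * bracket x)) • (2 • innerSL ℝ x) = _
  ext y
  have := (bracket_pos x).ne'
  simp
  field_simp

theorem fderiv_radial {N : ℕ} {F F' : ℝ → ℝ} (h1 : ∀ s, 0 < s → HasDerivAt F (F' s) s)
    (x : Space N) (i : Fin N) :
    fderiv ℝ (fun y => F (bracket y)) x (stdVec i) = F' (bracket x) * (x i * (bracket x)⁻¹) := by
  have := ((h1 _ (bracket_pos x)).comp_hasFDerivAt x (hasFDerivAt_bracket x)).fderiv
  rw [show (fun y => F (bracket y)) = F ∘ bracket from rfl, this]
  simp only [smul_apply, innerSL_apply_apply,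
    EuclideanSpace.inner_single_right, smul_eq_mul]
  simp [mul_comm]

/-- The chain rule with |∇⟨x⟩|² = 1 - 1/⟨x⟩² and Δ⟨x⟩ = (N-1)/⟨x⟩ + 1/⟨x⟩³. Using ⟨x⟩ instead of |x|
avoids the singularity at the origin and makes V exactly μ/⟨x⟩. -/
theorem laplacian_radial {N : ℕ} {F F' F'' : ℝ → ℝ} (h1 : ∀ s, 0 < s → HasDerivAt F (F' s) s)
    (h2 : ∀ s, 0 < s → HasDerivAt F' (F'' s) s)
    (hF : ContDiff ℝ 2 (fun y : Space N => F (bracket y))) (x : Space N) :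
    Δ (fun y : Space N => F (bracket y)) x = F'' (bracket x) * (1 - 1 / bracket x ^ 2) +
      F' (bracket x) * ((N - 1) / bracket x + 1 / bracket x ^ 3) := by
  rw [laplacian_eq_sum_fderiv hF]
  have hs := bracket_pos x
  have key : ∀ i : Fin N, fderiv ℝ (fun y => fderiv ℝ (fun y => F (bracket y)) y (stdVec i)) x
      (stdVec i) = (x i) ^ 2 * (F'' (bracket x) / bracket x ^ 2 - F' (bracket x) / bracket x ^ 3) +
        F' (bracket x) / bracket x := by
    intro i
    simp_rw [fderiv_radial h1]
    have a1 := (h2 _ hs).comp_hasFDerivAt x (hasFDerivAt_bracket x)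
    have a2 : HasFDerivAt (fun y : Space N => y i) (EuclideanSpace.proj i : Space N →L[ℝ] ℝ) x :=
      (EuclideanSpace.proj i : Space N →L[ℝ] ℝ).hasFDerivAt
    have a3 := (hasDerivAt_inv hs.ne').comp_hasFDerivAt x (hasFDerivAt_bracket x)
    have a4 := (a1.mul (a2.mul a3)).fderiv
    have e : (fun y => F' (bracket y) * (y i * (bracket y)⁻¹)) =
      (F' ∘ bracket) * ((fun y : Space N => y i) * (Inv.inv ∘ bracket)) := rfl
    rw [e, a4]
    simp [EuclideanSpace.inner_single_right]
    field_simp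
    ring
  simp_rw [key]
  rw [Finset.sum_add_distrib, ← Finset.sum_mul]
  have hn : ∑ i, (x i) ^ 2 = bracket x ^ 2 - 1 := by
    rw [bracket_sq, EuclideanSpace.norm_sq_eq]
    simp
  rw [hn]
  simp
  field_simp
  ring

/-! ### The truncated exponential. -/

theorem hasDerivAt_comp_max_zero {f f' : ℝ → ℝ} (hf : ∀ t, HasDerivAt f (f' t) t) (h0 : f' 0 = 0)
    (t : ℝ) : HasDerivAt (fun s => f (max s 0)) (f' (max t 0)) t := by
  rcases lt_trichotomy t 0 with ht | rfl | ht
  · rw [max_eq_right ht.le, h0]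
    refine (hasDerivAt_const t (f 0)).congr_of_eventuallyEq ?_
    filter_upwards [Iio_mem_nhds ht] with s hs
    rw [max_eq_right (le_of_lt hs)]
  · rw [max_self, ← hasDerivWithinAt_univ, ← Iic_union_Ici (a := (0 : ℝ))]
    refine HasDerivWithinAt.union ?_ ?_
    · rw [h0]
      refine (hasDerivWithinAt_const (0 : ℝ) (Iic 0) (f 0)).congr (fun s hs => ?_) (by simp)
      rw [max_eq_right hs]
    · refine (hf 0).hasDerivWithinAt.congr (fun s hs => ?_) (by simp)
      rw [max_eq_left hs]
  · rw [max_eq_left ht.le]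
    refine (hf t).congr_of_eventuallyEq ?_
    filter_upwards [Ioi_mem_nhds ht] with s hs
    rw [max_eq_left (le_of_lt hs)]

/-- The third-order remainder `e^τ - 1 - τ - τ²/2` of the exponential, cut off at `τ = 0`. -/
noncomputable def expRem (τ : ℝ) : ℝ :=
  Real.exp (max τ 0) - 1 - max τ 0 - (max τ 0) ^ 2 / 2

theorem hasDerivAt_expRem (τ : ℝ) :
    HasDerivAt expRem (Real.exp (max τ 0) - 1 - max τ 0) τ := by
  refine hasDerivAt_comp_max_zero (f := fun m => Real.exp m - 1 - m - m ^ 2 / 2)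
    (f' := fun m => Real.exp m - 1 - m) (fun t => ?_) (by simp) τ
  have h := (((Real.hasDerivAt_exp t).sub_const 1).sub (hasDerivAt_id t)).sub
    (((hasDerivAt_id t).pow 2).div_const 2)
  refine h.congr_deriv ?_
  simp

theorem hasDerivAt_expRem_deriv (τ : ℝ) :
    HasDerivAt (fun τ => Real.exp (max τ 0) - 1 - max τ 0) (Real.exp (max τ 0) - 1) τ := by
  refine hasDerivAt_comp_max_zero (f := fun m => Real.exp m - 1 - m)
    (f' := fun m => Real.exp m - 1) (fun t => ?_) (by simp) τ
  exact ((Real.hasDerivAt_exp t).sub_const 1).sub (hasDerivAt_id t)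

/-- Subtracting the Taylor polynomial of degree 2 makes the cut at 0 invisible up to second order,
so that Green's identity applies to compositions with `expRem`. -/
theorem contDiff_expRem : ContDiff ℝ 2 expRem := by
  have h1 : deriv expRem = fun τ => Real.exp (max τ 0) - 1 - max τ 0 :=
    funext fun τ => (hasDerivAt_expRem τ).deriv
  have h2 : deriv (fun τ => Real.exp (max τ 0) - 1 - max τ 0) = fun τ => Real.exp (max τ 0) - 1 :=
    funext fun τ => (hasDerivAt_expRem_deriv τ).deriv
  rw [show (2 : WithTop ℕ∞) = 1 + 1 by norm_num, contDiff_succ_iff_deriv]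
  refine ⟨fun τ => (hasDerivAt_expRem τ).differentiableAt, by simp, ?_⟩
  rw [h1, contDiff_one_iff_deriv]
  refine ⟨fun τ => (hasDerivAt_expRem_deriv τ).differentiableAt, ?_⟩
  rw [h2]
  fun_prop

/-! ### Growth of φ through a radial subsolution. -/

/-- For large `s`, `s + a log s - b / s` is the logarithm of a radial subsolution. -/
theorem exists_subsolution_exponents (n μ a : ℝ) (hn : 0 ≤ n) (ha : 0 ≤ a) (haμ : 2 * a = n + μ) :
    ∃ b : ℝ, 0 ≤ b ∧ ∃ s₀ : ℝ, 1 ≤ s₀ ∧ ∀ s, s₀ ≤ s →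
      1 + μ / s ≤ ((1 + a / s + b / s ^ 2) ^ 2 + a / s ^ 2 + 2 * b / s ^ 3) * (1 - 1 / s ^ 2) -
        (1 + a / s + b / s ^ 2) * (n / s + 1 / s ^ 3) := by
  -- The subsolution is e^{-P} with P = s + a log s - b/s. In its inequality the orders 1 and 1/s
  -- balance because 2a = n + μ; b is chosen to make the coefficient of 1/s² positive.
  set b := a * n + 1 with hb
  have hb0 : 0 ≤ b := by positivity
  -- The difference of the two sides is s⁻² q(s⁻¹), so q(0) > 0 and continuity settle all large s.
  let q : ℝ → ℝ := fun t => (a ^ 2 + 2 * b + a - 1 - a * n) +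
    t * (2 * a * b + 2 * b - 2 * a - b * n - 1) + t ^ 2 * (b ^ 2 - (a ^ 2 + 2 * b + a) - a) +
    t ^ 3 * (-(2 * a * b + 2 * b) - b) - b ^ 2 * t ^ 4
  have hq : Continuous q := by fun_prop
  have hq0 : 0 < q 0 := by
    simp only [q, hb]
    nlinarith [mul_nonneg ha hn, sq_nonneg a]
  have hev : ∀ᶠ s : ℝ in atTop, 0 < q s⁻¹ :=
    tendsto_inv_atTop_zero.eventually ((hq.tendsto 0).eventually (lt_mem_nhds hq0))
  obtain ⟨s₀, hs₀⟩ := eventually_atTop.1 hev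
  refine ⟨b, hb0, max s₀ 1, le_max_right _ _, fun s hs => ?_⟩
  have hs1 : 0 < s := one_pos.trans_le ((le_max_right _ _).trans hs)
  have h1 := hs₀ s ((le_max_left _ _).trans hs)
  have h2 : 0 ≤ (s⁻¹) ^ 2 * q s⁻¹ := by positivity
  obtain rfl : μ = 2 * a - n := by linarith
  rw [← sub_nonneg]
  convert h2 using 1
  simp only [q]
  field_simp
  ring

/-- A positive solution of `Δφ = (1 + V) φ` has mass `O(e^r (1 + r)^{(N-1+μ)/2})` in the ball of
radius `r`. -/
theorem exists_mass_bound {N : ℕ} (hN : 1 ≤ N) {μ : ℝ} (hμ : 0 ≤ μ) {φ : Space N → ℝ}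
    (hφ : ContDiff ℝ 2 φ) (hpos : ∀ x, 0 < φ x)
    (heq : ∀ x, Δ φ x = (1 + damping μ x) * φ x) :
    ∃ C : ℝ, 0 < C ∧ ∀ r : ℝ, 0 ≤ r → ∫ x in Metric.closedBall (0 : Space N) r, φ x ≤
      C * (Real.exp r * (1 + r) ^ (((N : ℝ) - 1 + μ) / 2)) := by
  have hn : (0 : ℝ) ≤ (N : ℝ) - 1 := by
    have : (1 : ℝ) ≤ N := by exact_mod_cast hN
    linarith
  set n : ℝ := (N : ℝ) - 1 with hn_def
  set a : ℝ := (n + μ) / 2 with ha_def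
  have ha : 0 ≤ a := by positivity
  obtain ⟨b, hb, s₀, hs₀, hsub⟩ := exists_subsolution_exponents n μ a hn ha (by rw [ha_def]; ring)
  let P : ℝ → ℝ := fun s => s + a * Real.log s - b / s
  let γ : ℝ → ℝ := fun s => 1 + a / s + b / s ^ 2
  have hP : ∀ s, 0 < s → HasDerivAt P (γ s) s := by
    intro s hs
    have h := ((hasDerivAt_id s).add ((Real.hasDerivAt_log hs.ne').const_mul a)).sub
      ((hasDerivAt_inv hs.ne').const_mul b)
    have e : P = (id + fun s => a * Real.log s) - fun s => b * s⁻¹ := by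
      ext s; simp [P, div_eq_mul_inv]
    rw [e]
    refine h.congr_deriv ?_
    simp only [γ]
    field_simp
    ring
  have hγ : ∀ s, 0 < s → HasDerivAt γ (-(a / s ^ 2 + 2 * b / s ^ 3)) s := by
    intro s hs
    have h := ((hasDerivAt_inv hs.ne').const_mul a).const_add 1 |>.add
      (((hasDerivAt_pow 2 s).inv (by positivity)).const_mul b)
    have e : γ = (fun s => 1 + a * s⁻¹) + fun s => b * (s ^ 2)⁻¹ := by
      ext s; simp [γ, div_eq_mul_inv]
    rw [e]
    refine h.congr_deriv ?_
    simp
    field_simp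
    ring
  have hP1 : ∀ s, 1 ≤ s → s - b ≤ P s := by
    intro s hs
    have h1 : 0 ≤ a * Real.log s := mul_nonneg ha (Real.log_nonneg hs)
    have h2 : b / s ≤ b := div_le_self hb hs
    simp only [P]
    linarith
  have hPmono : ∀ s t, 1 ≤ s → s ≤ t → P s ≤ P t := by
    intro s t hs hst
    have h0 : 0 < s := by linarith
    have h1 : Real.log s ≤ Real.log t := Real.log_le_log h0 hst
    have h2 : b / t ≤ b / s := div_le_div_of_nonneg_left hb h0 hst
    have h3 := mul_le_mul_of_nonneg_left h1 ha
    simp only [P]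
    linarith
  set B : Set (Space N) := Metric.closedBall 0 s₀ with hB
  have hφint : ∀ r, IntegrableOn φ (Metric.closedBall (0 : Space N) r) := fun r =>
    hφ.continuous.continuousOn.integrableOn_compact (isCompact_closedBall _ _)
  set I : ℝ := ∫ x in B, φ x with hI
  have hI0 : 0 ≤ I := integral_nonneg fun x => (hpos x).le
  set A : ℝ := Real.exp b * ((1 + a + b) * (n + 1) + 1 + μ) with hA
  have hA0 : 0 ≤ A := by positivity
  have main : ∀ r : ℝ, 0 ≤ r → ∫ x in Metric.closedBall (0 : Space N) r, φ x ≤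
      (A * Real.exp (2 + P (1 + r)) + 1) * I := by
    intro r hr
    -- With this level ρ - P(⟨x⟩) ≥ 2 on the ball of radius r, which makes the gain m²/2 below at
    -- least 1 there.
    set ρ : ℝ := 2 + P (1 + r) with hρ
    let F : ℝ → ℝ := fun s => expRem (ρ - P s)
    let g1 : ℝ → ℝ := fun s => Real.exp (max (ρ - P s) 0) - 1 - max (ρ - P s) 0
    let g2 : ℝ → ℝ := fun s => Real.exp (max (ρ - P s) 0) - 1
    have hF1 : ∀ s, 0 < s → HasDerivAt F (-(g1 s * γ s)) s := fun s hs => by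
      have := (hasDerivAt_expRem (ρ - P s)).comp s ((hP s hs).const_sub ρ)
      refine this.congr_deriv ?_
      simp [g1]
    have hF2 : ∀ s, 0 < s → HasDerivAt (fun s => -(g1 s * γ s))
        (g2 s * γ s ^ 2 + g1 s * (a / s ^ 2 + 2 * b / s ^ 3)) s := fun s hs => by
      have h1 := (hasDerivAt_expRem_deriv (ρ - P s)).comp s ((hP s hs).const_sub ρ)
      have h2 := (h1.mul (hγ s hs)).neg
      refine h2.congr_deriv ?_
      simp only [g1, g2, Function.comp]
      ring
    let h : Space N → ℝ := fun x => F (bracket x)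
    have hh : ContDiff ℝ 2 h := by
      refine contDiff_expRem.comp (contDiff_const.sub ?_)
      have hb0 : ∀ x : Space N, bracket x ≠ 0 := fun x => (bracket_pos x).ne'
      exact (contDiff_bracket.add (contDiff_const.mul (contDiff_bracket.log hb0))).sub
        (contDiff_const.div contDiff_bracket hb0)
    have hhc : HasCompactSupport h := by
      refine HasCompactSupport.intro (isCompact_closedBall (0 : Space N) (ρ + b)) fun x hx => ?_
      have hx' : ρ + b < ‖x‖ := by simpa using hx
      have h1 := hP1 _ (one_le_bracket x)
      have h2 := norm_le_bracket x
      have h3 : max (ρ - P (bracket x)) 0 = 0 := max_eq_right (by linarith)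
      simp [h, F, expRem, h3]
    let D : Space N → ℝ := fun x => Δ h x - (1 + damping μ x) * h x
    have hlapc : Continuous (Δ h) := continuous_laplacian hh
    have hVc : Continuous (damping μ : Space N → ℝ) := by
      refine continuous_const.div (by fun_prop) fun x => ?_
      exact (bracket_pos x).ne'
    have hDc : Continuous D := hlapc.sub ((continuous_const.add hVc).mul hh.continuous)
    have hDs : HasCompactSupport D :=
      (hasCompactSupport_laplacian hhc).sub hhc.mul_left
    have hDint : Integrable fun x => φ x * D x :=
      (hφ.continuous.mul hDc).integrable_of_hasCompactSupport hDs.mul_left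
    -- The duality: φ annihilates Δh - (1+V)h for every compactly supported C² function h. Hence the
    -- part of D that is positive far out is paid for by its negative part near the origin.
    have hzero : ∫ x, φ x * D x = 0 := by
      have e : (fun x => φ x * D x) = fun x => φ x * Δ h x - Δ φ x * h x := by
        ext x; simp only [D]; rw [heq]; ring
      rw [e, integral_sub, integral_mul_laplacian_comm hφ hh hhc, sub_self]
      · exact (hφ.continuous.mul hlapc).integrable_of_hasCompactSupport
          (hasCompactSupport_laplacian hhc).mul_left
      · exact ((continuous_laplacian hφ).mul hh.continuous).integrable_of_hasCompactSupport
          hhc.mul_left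
    have hlap : ∀ x, D x = (g2 (bracket x) * γ (bracket x) ^ 2 +
        g1 (bracket x) * (a / bracket x ^ 2 + 2 * b / bracket x ^ 3)) * (1 - 1 / bracket x ^ 2) -
        g1 (bracket x) * γ (bracket x) * (n / bracket x + 1 / bracket x ^ 3) -
        (1 + μ / bracket x) * h x := by
      intro x
      simp only [D]
      rw [laplacian_radial hF1 hF2 hh x]
      simp only [damping, bracket]
      ring
    -- elementary inequalities for the truncated remainder
    have hm : ∀ s, g1 s = F s + (max (ρ - P s) 0) ^ 2 / 2 := fun s => by
      simp only [g1, F, expRem]; ring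
    have hF0 : ∀ s, 0 ≤ F s := fun s => by
      have := Real.quadratic_le_exp_of_nonneg (le_max_right (ρ - P s) 0)
      simp only [F, expRem]; linarith
    have hg12 : ∀ s, g1 s ≤ g2 s := fun s => by
      simp only [g1, g2]; linarith [le_max_right (ρ - P s) 0]
    have hg10 : ∀ s, 0 ≤ g1 s := fun s => by
      rw [hm]; have := hF0 s; positivity
    -- Write m = max(ρ - P, 0). The functions `F`, `g1`, `g2` are `expRem` and its first two
    -- derivatives at ρ - P, and F ≤ g1 ≤ g2. The subsolution inequality is multiplied by g1, the
    -- second-order term only gains from g2 ≥ g1, and g1 = F + m²/2 leaves the surplus.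
    have hout : ∀ x, s₀ ≤ bracket x →
        (1 + μ / bracket x) * ((max (ρ - P (bracket x)) 0) ^ 2 / 2) ≤ D x := by
      intro x hx
      have h1 := hsub _ hx
      have hs := one_le_bracket x
      set s := bracket x
      have h2 : 0 ≤ 1 - 1 / s ^ 2 := by
        rw [sub_nonneg, div_le_one (by positivity)]
        exact one_le_pow₀ hs
      have h3 : g1 s * (1 + μ / s) ≤ g1 s * _ := mul_le_mul_of_nonneg_left h1 (hg10 s)
      have h4 : 0 ≤ (g2 s - g1 s) * (γ s ^ 2 * (1 - 1 / s ^ 2)) :=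
        mul_nonneg (sub_nonneg.2 (hg12 s)) (by positivity)
      have h5 : h x = g1 s - (max (ρ - P s) 0) ^ 2 / 2 := by
        rw [hm s]; simp [h, s]
      rw [hlap, h5]
      simp only [γ] at h4 ⊢
      linarith
    -- A crude bound valid everywhere, needed only near the origin where e^{-P} need not be a
    -- subsolution. It has to be linear in e^ρ, since e^ρ carries the final growth rate.
    have hin : ∀ x, -(A * Real.exp ρ) ≤ D x := by
      intro x
      have hs := one_le_bracket x
      have hP1s := hP1 _ hs
      set s := bracket x
      have h2 : 0 ≤ 1 - 1 / s ^ 2 := by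
        rw [sub_nonneg, div_le_one (by positivity)]
        exact one_le_pow₀ hs
      have hg1e : g1 s ≤ Real.exp (b + ρ) := by
        rcases le_total (ρ - P s) 0 with h0 | h0
        · simp only [g1, max_eq_right h0]
          simp [Real.exp_nonneg]
        · have : Real.exp (ρ - P s) ≤ Real.exp (b + ρ) := Real.exp_le_exp.2 (by linarith)
          simp only [g1, max_eq_left h0]
          linarith
      have hγs : γ s ≤ 1 + a + b := by
        have e1 : a / s ≤ a := div_le_self ha hs
        have e2 : b / s ^ 2 ≤ b := div_le_self hb (one_le_pow₀ hs)
        simp only [γ]; linarith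
      have hγ0 : 0 ≤ γ s := by simp only [γ]; positivity
      have hns : n / s + 1 / s ^ 3 ≤ n + 1 := by
        have e1 : n / s ≤ n := div_le_self hn hs
        have e2 : 1 / s ^ 3 ≤ 1 := div_le_self zero_le_one (one_le_pow₀ hs)
        linarith
      have hμs : μ / s ≤ μ := div_le_self hμ hs
      have hhx : h x ≤ g1 s := by
        rw [hm s]; simp only [h]; have : 0 ≤ (max (ρ - P s) 0) ^ 2 / 2 := by positivity
        linarith
      have hh0 : 0 ≤ h x := hF0 s
      have i1 : g1 s * γ s * (n / s + 1 / s ^ 3) ≤ Real.exp (b + ρ) * (1 + a + b) * (n + 1) := by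
        have := hg10 s
        gcongr
      have i2 : (1 + μ / s) * h x ≤ (1 + μ) * Real.exp (b + ρ) := by
        have := hhx.trans hg1e
        gcongr
      have i3 : 0 ≤ (g2 s * γ s ^ 2 + g1 s * (a / s ^ 2 + 2 * b / s ^ 3)) * (1 - 1 / s ^ 2) := by
        have e1 := hg10 s
        have e2 := e1.trans (hg12 s)
        positivity
      rw [hlap, hA]
      rw [Real.exp_add] at i1 i2
      linarith
    -- compare `φ D` with `φ` on the two regions
    have hptw : ∀ x, (Metric.closedBall (0 : Space N) r).indicator φ x -
        (A * Real.exp ρ + 1) * B.indicator φ x ≤ φ x * D x := by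
      intro x
      have hx0 := (hpos x).le
      by_cases hxB : x ∈ B
      · rw [indicator_of_mem hxB]
        have h1 : (Metric.closedBall (0 : Space N) r).indicator φ x ≤ φ x :=
          indicator_le_self' (fun _ _ => hx0) x
        have h2 := mul_le_mul_of_nonneg_left (hin x) hx0
        linarith
      · rw [indicator_of_notMem hxB]
        have hxs : s₀ ≤ bracket x := by
          have : s₀ < ‖x‖ := by simpa [hB] using hxB
          exact this.le.trans (norm_le_bracket x)
        have h1 := hout x hxs
        have hs := bracket_pos x
        by_cases hxr : x ∈ Metric.closedBall (0 : Space N) r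
        · rw [indicator_of_mem hxr]
          have hxr' : ‖x‖ ≤ r := by simpa using hxr
          have h2 : P (bracket x) ≤ P (1 + r) :=
            hPmono _ _ (one_le_bracket x) ((bracket_le x).trans (by linarith))
          have h3 : 2 ≤ max (ρ - P (bracket x)) 0 := le_max_of_le_left (by linarith)
          have h4 : 1 ≤ D x := by
            refine le_trans ?_ h1
            have e1 : 0 ≤ μ / bracket x := by positivity
            nlinarith
          nlinarith
        · rw [indicator_of_notMem hxr]
          have : 0 ≤ D x := le_trans (by positivity) h1
          have := mul_nonneg hx0 this
          linarith
    have i1 : Integrable ((Metric.closedBall (0 : Space N) r).indicator φ) :=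
      (hφint r).integrable_indicator Metric.isClosed_closedBall.measurableSet
    have i2 : Integrable (B.indicator φ) :=
      (hφint s₀).integrable_indicator Metric.isClosed_closedBall.measurableSet
    have h1 := integral_mono (i1.sub (i2.const_mul _)) hDint hptw
    rw [hzero] at h1
    simp only [Pi.sub_apply] at h1
    rw [integral_sub i1 (i2.const_mul _), integral_const_mul,
      integral_indicator Metric.isClosed_closedBall.measurableSet,
      integral_indicator Metric.isClosed_closedBall.measurableSet] at h1
    linarith
  -- The exponent 3 is 2 from the level ρ plus 1 from P(1+r) ≤ 1 + r + a log(1+r).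
  refine ⟨(A * Real.exp 3 + 1) * (I + 1), by positivity, fun r hr => (main r hr).trans ?_⟩
  have h1 : (1 : ℝ) ≤ 1 + r := by linarith
  have hpow : Real.exp (a * Real.log (1 + r)) = (1 + r) ^ a := by
    rw [Real.rpow_def_of_pos (by linarith), mul_comm]
  have hX1 : 1 ≤ Real.exp r * (1 + r) ^ a := by
    have e1 := Real.one_le_exp hr
    have e2 := Real.one_le_rpow h1 ha
    nlinarith
  have hexp : Real.exp (2 + P (1 + r)) ≤ Real.exp 3 * (Real.exp r * (1 + r) ^ a) := by
    rw [← hpow, ← Real.exp_add, ← Real.exp_add]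
    refine Real.exp_le_exp.2 ?_
    have : 0 ≤ b / (1 + r) := by positivity
    simp only [P]
    linarith
  set X := Real.exp r * (1 + r) ^ a
  have h2 : A * Real.exp (2 + P (1 + r)) + 1 ≤ (A * Real.exp 3 + 1) * X := by
    have := mul_le_mul_of_nonneg_left hexp hA0
    linarith
  calc (A * Real.exp (2 + P (1 + r)) + 1) * I ≤ ((A * Real.exp 3 + 1) * X) * (I + 1) := by
        have : 0 ≤ A * Real.exp (2 + P (1 + r)) + 1 := by positivity
        gcongr
        linarith
    _ = _ := by ring

/-! ### Smooth approximation of φ on balls. -/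

open scoped Convolution

theorem fderiv_convolution_apply {N : ℕ} {f g : Space N → ℝ} (hf : LocallyIntegrable f)
    (hg : ContDiff ℝ 1 g) (hc : HasCompactSupport g) (x e : Space N) :
    fderiv ℝ (f ⋆[ContinuousLinearMap.lsmul ℝ ℝ, volume] g) x e =
      (f ⋆[ContinuousLinearMap.lsmul ℝ ℝ, volume] fun y => fderiv ℝ g y e) x := by
  rw [(hc.hasFDerivAt_convolution_right _ hf hg x).fderiv,
    convolution_precompR_apply _ hf (hc.fderiv ℝ) (hg.continuous_fderiv (by norm_num))]

theorem laplacian_convolution {N : ℕ} {f g : Space N → ℝ} (hf : LocallyIntegrable f)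
    (hg : ContDiff ℝ 2 g) (hc : HasCompactSupport g) (x : Space N) :
    Δ (f ⋆[ContinuousLinearMap.lsmul ℝ ℝ, volume] g) x =
      (f ⋆[ContinuousLinearMap.lsmul ℝ ℝ, volume] Δ g) x := by
  have h1 : ∀ i : Fin N, ContDiff ℝ 1 fun y => fderiv ℝ g y (stdVec i) :=
    fun i => contDiff_fderiv_apply hg (by norm_num) _
  have hc1 : ∀ i : Fin N, HasCompactSupport fun y => fderiv ℝ g y (stdVec i) :=
    fun i => hc.fderiv_apply (𝕜 := ℝ) _
  have hL : Δ g = fun x => ∑ i, fderiv ℝ (fun y => fderiv ℝ g y (stdVec i)) x (stdVec i) :=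
    funext fun x => laplacian_eq_sum_fderiv hg x
  rw [laplacian_eq_sum_fderiv (hc.contDiff_convolution_right (n := 2) _ hf hg), hL]
  simp_rw [fderiv_convolution_apply hf (hg.of_le (by norm_num)) hc,
    fun i y => fderiv_convolution_apply hf (h1 i) (hc1 i) y (stdVec i), convolution_def, map_sum]
  rw [integral_finsetSum]
  intro i _
  exact ((hc1 i).fderiv_apply (𝕜 := ℝ) (stdVec i)).convolutionExists_right _ hf
    (contDiff_fderiv_apply (m := 0) (h1 i) (by norm_num) _).continuous x

/-- A nonnegative `C²` function and its Laplacian are uniformly approximated on a ball by a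
nonnegative test function. -/
theorem exists_smooth_approx {N : ℕ} {φ : Space N → ℝ} (hφ : ContDiff ℝ 2 φ)
    (hpos : ∀ x, 0 ≤ φ x) (ρ : ℝ) {δ : ℝ} (hδ : 0 < δ) :
    ∃ Φ : Space N → ℝ, ContDiff ℝ ∞ Φ ∧ HasCompactSupport Φ ∧ (∀ x, 0 ≤ Φ x) ∧
      ∀ x, ‖x‖ ≤ ρ → |Φ x - φ x| ≤ δ ∧ |Δ Φ x - Δ φ x| ≤ δ := by
  -- The cutoff equals 1 on a ball strictly larger than radius ρ, so κφ and φ have the same germ,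
  -- hence the same Laplacian, at every point with ‖x‖ ≤ ρ.
  let κ : ContDiffBump (0 : Space N) := ⟨|ρ| + 1, |ρ| + 2, by positivity, by linarith⟩
  let g : Space N → ℝ := fun x => κ x * φ x
  have hg : ContDiff ℝ 2 g := κ.contDiff.mul hφ
  have hgc : HasCompactSupport g := κ.hasCompactSupport.mul_right
  have hg0 : ∀ x, 0 ≤ g x := fun x => mul_nonneg κ.nonneg (hpos x)
  have heq : ∀ x : Space N, ‖x‖ ≤ ρ → g =ᶠ[𝓝 x] φ := fun x hx => by
    have : Metric.ball (0 : Space N) (|ρ| + 1) ∈ 𝓝 x := by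
      refine Metric.isOpen_ball.mem_nhds ?_
      rw [mem_ball_zero_iff]
      linarith [le_abs_self ρ]
    filter_upwards [this] with y hy
    simp only [g]
    rw [κ.one_of_mem_closedBall (Metric.ball_subset_closedBall hy), one_mul]
  have hlc : Continuous (Δ g) := continuous_laplacian hg
  have hls : HasCompactSupport (Δ g) := hasCompactSupport_laplacian hgc
  obtain ⟨r₁, hr₁, H₁⟩ := Metric.uniformContinuous_iff.1
    (hg.continuous.uniformContinuous_of_tendsto_cocompact hgc.is_zero_at_infty) δ hδ
  obtain ⟨r₂, hr₂, H₂⟩ := Metric.uniformContinuous_iff.1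
    (hlc.uniformContinuous_of_tendsto_cocompact hls.is_zero_at_infty) δ hδ
  have hr : 0 < min r₁ r₂ := lt_min hr₁ hr₂
  -- The mollifier's radius is within both moduli of uniform continuity. The Laplacian falls on g,
  -- so one convolution approximates both g and Δg.
  let ψ : ContDiffBump (0 : Space N) := ⟨min r₁ r₂ / 2, min r₁ r₂, by positivity, by linarith⟩
  let w : Space N → ℝ := ψ.normed volume
  have hw : LocallyIntegrable w := ψ.continuous_normed.locallyIntegrable
  refine ⟨w ⋆[ContinuousLinearMap.lsmul ℝ ℝ, volume] g, ?_, ?_, ?_, ?_⟩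
  · exact ψ.hasCompactSupport_normed.contDiff_convolution_left _ ψ.contDiff_normed
      hg.continuous.locallyIntegrable
  · exact ψ.hasCompactSupport_normed.convolution _ hgc
  · intro x
    rw [convolution_def]
    exact integral_nonneg fun t => mul_nonneg (ψ.nonneg_normed t) (hg0 _)
  · intro x hx
    rw [laplacian_convolution hw hg hgc, ← (heq x hx).eq_of_nhds,
      ← (InnerProductSpace.laplacian_congr_nhds (heq x hx)).eq_of_nhds]
    constructor
    · refine ψ.dist_normed_convolution_le hg.continuous.aestronglyMeasurable fun y hy => ?_
      exact (H₁ (lt_of_lt_of_le (Metric.mem_ball.1 hy) (min_le_left _ _))).le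
    · refine ψ.dist_normed_convolution_le hlc.aestronglyMeasurable fun y hy => ?_
      exact (H₂ (lt_of_lt_of_le (Metric.mem_ball.1 hy) (min_le_right _ _))).le

/-! ### Functionals on L², supports and measurability. -/

/-- The functional `w ↦ ∫ w χ` on `L²`. -/
noncomputable def pairing {N : ℕ} {χ : Space N → ℝ} (hχ : MemLp χ 2 (volume : Measure (Space N))) :
    L2 N →L[ℝ] ℝ := innerSL ℝ (hχ.toLp χ)

theorem pairing_apply {N : ℕ} {χ : Space N → ℝ} (hχ : MemLp χ 2 (volume : Measure (Space N)))
    (w : L2 N) : pairing hχ w = ∫ x, w x * χ x := by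
  rw [pairing, innerSL_apply_apply, L2.inner_def]
  refine integral_congr_ae ?_
  filter_upwards [hχ.coeFn_toLp] with x hx
  rw [hx]
  rfl

/-- An L²-convergent sequence has an almost everywhere convergent subsequence. This transfers
support conditions to the limit of difference quotients. -/
theorem isClosed_vanishing {N : ℕ} (S : Set (Space N)) :
    IsClosed {w : L2 N | ∀ᵐ x, x ∈ S → w x = 0} := by
  refine IsSeqClosed.isClosed fun w w₀ hw hlim => ?_
  obtain ⟨ns, -, hns⟩ := (tendstoInMeasure_of_tendsto_Lp hlim).exists_seq_tendsto_ae
  filter_upwards [hns, ae_all_iff.2 hw] with x hx hx0 hxS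
  refine tendsto_nhds_unique hx ?_
  simp_rw [fun n => hx0 (ns n) hxS]
  exact tendsto_const_nhds

/-- Fatou's lemma along an almost everywhere convergent subsequence. Continuity cannot be expected,
since p may exceed 2 and the integral may be infinite. -/
theorem lowerSemicontinuous_lintegral_rpow {N : ℕ} {p : ℝ} (hp : 0 ≤ p) {Φ : Space N → ℝ}
    (hΦ : Continuous Φ) :
    LowerSemicontinuous fun w : L2 N => ∫⁻ x, ‖|w x| ^ p * Φ x‖ₑ := by
  rw [lowerSemicontinuous_iff_isClosed_preimage]
  refine fun c => IsSeqClosed.isClosed fun w w₀ hw hlim => ?_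
  obtain ⟨ns, -, hns⟩ := (tendstoInMeasure_of_tendsto_Lp hlim).exists_seq_tendsto_ae
  have hcont : Continuous fun r : ℝ => |r| ^ p :=
    (Real.continuous_rpow_const hp).comp continuous_abs
  calc ∫⁻ x, ‖|w₀ x| ^ p * Φ x‖ₑ
      = ∫⁻ x, liminf (fun n => ‖|w (ns n) x| ^ p * Φ x‖ₑ) atTop := by
        refine lintegral_congr_ae ?_
        filter_upwards [hns] with x hx
        refine (Tendsto.liminf_eq ?_).symm
        exact (((hcont.tendsto _).comp hx).mul_const _).enorm
    _ ≤ liminf (fun n => ∫⁻ x, ‖|w (ns n) x| ^ p * Φ x‖ₑ) atTop := by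
        refine lintegral_liminf_le' fun n => ?_
        exact ((hcont.comp_aestronglyMeasurable (Lp.aestronglyMeasurable _)).mul
          hΦ.aestronglyMeasurable).enorm
    _ ≤ c := by
        refine (liminf_le_liminf (Eventually.of_forall fun n => hw (ns n))).trans ?_
        simp

/-- A lower semicontinuous function of a continuous curve in L² is measurable in time, so no jointly
measurable representative of ∂ₜu is required. -/
theorem aemeasurable_lintegral_rpow {N : ℕ} {p : ℝ} (hp : 0 ≤ p) {Φ : Space N → ℝ}
    (hΦ : Continuous Φ) {v : ℝ → L2 N} {s : Set ℝ} (hs : MeasurableSet s) (hv : ContinuousOn v s) :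
    AEMeasurable (fun t => ∫⁻ x, ‖|v t x| ^ p * Φ x‖ₑ) (volume.restrict s) := by
  let _ : MeasurableSpace (L2 N) := borel _
  have : BorelSpace (L2 N) := ⟨rfl⟩
  exact (lowerSemicontinuous_lintegral_rpow hp hΦ).measurable.comp_aemeasurable
    (hv.aemeasurable hs)

/-- The definition of the weak gradient is applied to the test functions ∂ᵢΦ in the directions eᵢ
and summed. -/
theorem integral_inner_grad {N : ℕ} (w : H1 N) {Φ : Space N → ℝ} (hΦ : ContDiff ℝ ∞ Φ)
    (hc : HasCompactSupport Φ) :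
    ∫ x, inner ℝ (grad w x) (∇ Φ x) = - ∫ x, fn w x * Δ Φ x := by
  have hd : ∀ i : Fin N, ContDiff ℝ ∞ fun y => fderiv ℝ Φ y (stdVec i) :=
    fun i => contDiff_fderiv_apply hΦ (by simp) _
  have hdc : ∀ i : Fin N, HasCompactSupport fun y => fderiv ℝ Φ y (stdVec i) :=
    fun i => hc.fderiv_apply (𝕜 := ℝ) _
  have hd2 : ∀ i : Fin N,
      Continuous fun x => fderiv ℝ (fun y => fderiv ℝ Φ y (stdVec i)) x (stdVec i) :=
    fun i => (contDiff_fderiv_apply (m := 0) (hd i) (by simp) _).continuous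
  have h1 : ∀ x, inner ℝ (grad w x) (∇ Φ x) =
      ∑ i, fderiv ℝ Φ x (stdVec i) * inner ℝ (grad w x) (stdVec i) := by
    intro x
    rw [← (EuclideanSpace.basisFun (Fin N) ℝ).sum_inner_mul_inner]
    refine Finset.sum_congr rfl fun i _ => ?_
    rw [EuclideanSpace.basisFun_apply, real_inner_comm (∇ Φ x), gradient,
      InnerProductSpace.toDual_symm_apply, mul_comm]
  have hΦ2 : ContDiff ℝ 2 Φ := by exact_mod_cast contDiff_infty.1 hΦ 2
  simp_rw [h1, laplacian_eq_sum_fderiv hΦ2, Finset.mul_sum]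
  rw [integral_finsetSum, integral_finsetSum, ← Finset.sum_neg_distrib]
  · refine Finset.sum_congr rfl fun i _ => ?_
    have := w.2 _ (hd i) (hdc i) (stdVec i)
    rw [eq_comm, neg_eq_iff_eq_neg]
    exact this
  · exact fun i _ => integrable_L2_mul (fn w) (hd2 i) ((hdc i).fderiv_apply (𝕜 := ℝ) _)
  · exact fun i _ => integrable_mul_inner_L2vec (grad w) (hd i).continuous (hdc i) _

theorem measurableSet_timeIoo (T : ℝ≥0∞) : MeasurableSet (timeIoo T) :=
  measurableSet_Ioi.inter (ENNReal.measurable_ofReal measurableSet_Iio)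

theorem mem_timeIco_of_le {T : ℝ≥0∞} {s t : ℝ} (ht : t ∈ timeIco T) (hs : 0 ≤ s) (hst : s ≤ t) :
    s ∈ timeIco T := ⟨hs, (ENNReal.ofReal_le_ofReal hst).trans_lt ht.2⟩

theorem Icc_subset_timeIco {T : ℝ≥0∞} {t : ℝ} (ht : ENNReal.ofReal t < T) :
    Icc 0 t ⊆ timeIco T := fun _ hs => ⟨hs.1, (ENNReal.ofReal_le_ofReal hs.2).trans_lt ht⟩

theorem Ioc_subset_timeIoo {T : ℝ≥0∞} {t : ℝ} (ht : ENNReal.ofReal t < T) :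
    Ioc 0 t ⊆ timeIoo T := fun _ hs => ⟨hs.1, (ENNReal.ofReal_le_ofReal hs.2).trans_lt ht⟩

/-- The time derivative of a solution supported in the cone is supported in the cone. -/
theorem deriv_supported {N : ℕ} {R : ℝ} {T : ℝ≥0∞} {u : ℝ → H1 N} {v : ℝ → L2 N}
    (hv : ∀ t ∈ timeIco T, HasDerivWithinAt (fun s => fn (u s)) (v t) (timeIco T) t)
    (hs : SupportedInCone R T u) {t : ℝ} (ht : t ∈ timeIco T) (ht0 : 0 < t) :
    ∀ᵐ x : Space N, R + t < ‖x‖ → v t x = 0 := by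
  -- Only left difference quotients are used: at times s < t the solution is supported in the
  -- smaller ball of radius R + s.
  have hsub : Ico 0 t ⊆ timeIco T := fun s hs => mem_timeIco_of_le ht hs.1 hs.2.le
  have h1 : HasDerivWithinAt (fun s => fn (u s)) (v t) (Ico 0 t) t := (hv t ht).mono hsub
  rw [hasDerivWithinAt_iff_tendsto_slope' (by simp)] at h1
  have : (𝓝[Ico 0 t] t).NeBot := by
    rw [← mem_closure_iff_nhdsWithin_neBot, closure_Ico ht0.ne]
    exact ⟨ht0.le, le_rfl⟩
  refine (isClosed_vanishing {x : Space N | R + t < ‖x‖}).mem_of_tendsto h1 ?_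
  filter_upwards [self_mem_nhdsWithin] with s hst
  have hss := hs s (hsub hst)
  have htt := hs t ht
  rw [slope_def_module]
  filter_upwards [hss, htt, Lp.coeFn_smul (s - t)⁻¹ (fn (u s) - fn (u t)),
    Lp.coeFn_sub (fn (u s)) (fn (u t))] with x h1 h2 h3 h4 hx
  have hx' : R + t < ‖x‖ := hx
  rw [h3, Pi.smul_apply, h4, Pi.sub_apply, h1 (by linarith [hst.2]), h2 hx']
  simp

/-- Integrals over `(0, T)` of functions vanishing after time `T'`. -/
theorem setIntegral_timeIoo {T : ℝ≥0∞} {T' : ℝ} (h0 : 0 ≤ T') (hT : ENNReal.ofReal T' < T)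
    {h : ℝ → ℝ} (hh : ∀ t, T' < t → h t = 0) :
    ∫ t in timeIoo T, h t = ∫ t in (0 : ℝ)..T', h t := by
  rw [intervalIntegral.integral_of_le h0]
  refine setIntegral_eq_of_subset_of_forall_sdiff_eq_zero (measurableSet_timeIoo T)
    (Ioc_subset_timeIoo hT) fun t ht => hh t ?_
  by_contra hle
  exact ht.2 ⟨ht.1.1, not_lt.1 hle⟩

/-- From |w| ≤ w² + 1. A crude bound suffices, as it only multiplies approximation errors that tend
to 0. -/
theorem integral_abs_le {N : ℕ} (w : L2 N) (r : ℝ) :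
    ∫ x in Metric.closedBall (0 : Space N) r, |w x| ≤
      ‖w‖ ^ 2 + volume.real (Metric.closedBall (0 : Space N) r) := by
  have hfin : volume (Metric.closedBall (0 : Space N) r) ≠ ⊤ := measure_closedBall_lt_top.ne
  have hsq : Integrable fun x => w x ^ 2 := (Lp.memLp w).integrable_sq
  have hnorm : ∫ x, w x ^ 2 = ‖w‖ ^ 2 := by
    rw [← real_inner_self_eq_norm_sq, L2.inner_def]
    simp
  have h1 : IntegrableOn (fun _ : Space N => (1 : ℝ)) (Metric.closedBall (0 : Space N) r) :=
    integrableOn_const hfin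
  calc ∫ x in Metric.closedBall (0 : Space N) r, |w x|
      ≤ ∫ x in Metric.closedBall (0 : Space N) r, (w x ^ 2 + 1) := by
        refine integral_mono_of_nonneg (Eventually.of_forall fun x => abs_nonneg _)
          (hsq.integrableOn.add h1) (Eventually.of_forall fun x => ?_)
        simp only
        nlinarith [sq_abs (w x), sq_nonneg (|w x| - 1), abs_nonneg (w x)]
    _ = (∫ x in Metric.closedBall (0 : Space N) r, w x ^ 2) +
          volume.real (Metric.closedBall (0 : Space N) r) := by
        rw [integral_add hsq.integrableOn h1]
        simp
    _ ≤ _ := by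
        gcongr
        rw [← hnorm]
        exact setIntegral_le_integral hsq (Eventually.of_forall fun x => sq_nonneg _)

theorem abs_integral_mul_le {N : ℕ} (w : L2 N) {r δ : ℝ} (hδ : 0 ≤ δ) {h : Space N → ℝ}
    (hw : ∀ᵐ x : Space N, r < ‖x‖ → w x = 0) (hh : ∀ x, ‖x‖ ≤ r → |h x| ≤ δ) :
    |∫ x, w x * h x| ≤ δ * (‖w‖ ^ 2 + volume.real (Metric.closedBall (0 : Space N) r)) := by
  have hfin : volume (Metric.closedBall (0 : Space N) r) ≠ ⊤ := measure_closedBall_lt_top.ne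
  have hint : IntegrableOn (fun x => |w x|) (Metric.closedBall (0 : Space N) r) := by
    have : IsFiniteMeasure (volume.restrict (Metric.closedBall (0 : Space N) r)) :=
      ⟨by simpa using hfin.lt_top⟩
    exact (((Lp.memLp w).restrict _).integrable (by norm_num)).abs
  calc |∫ x, w x * h x| ≤ ∫ x, |w x * h x| := abs_integral_le_integral_abs
    _ ≤ ∫ x, (Metric.closedBall (0 : Space N) r).indicator (fun x => δ * |w x|) x := by
        refine integral_mono_of_nonneg (Eventually.of_forall fun x => abs_nonneg _)
          (IntegrableOn.integrable_indicator (hint.const_mul δ)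
            Metric.isClosed_closedBall.measurableSet) ?_
        filter_upwards [hw] with x hx
        by_cases hxr : ‖x‖ ≤ r
        · rw [indicator_of_mem (by simpa using hxr), abs_mul, mul_comm]
          exact mul_le_mul_of_nonneg_right (hh x hxr) (abs_nonneg _)
        · rw [indicator_of_notMem (by simpa using hxr), hx (not_le.1 hxr)]
          simp
    _ = δ * ∫ x in Metric.closedBall (0 : Space N) r, |w x| := by
        rw [integral_indicator Metric.isClosed_closedBall.measurableSet, integral_const_mul]
    _ ≤ _ := mul_le_mul_of_nonneg_left (integral_abs_le w r) hδ

/-! ### The energy inequality. -/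

theorem continuous_damping {N : ℕ} (μ : ℝ) : Continuous (damping μ : Space N → ℝ) :=
  continuous_const.div (by fun_prop) fun x => (bracket_pos x).ne'

theorem damping_nonneg {N : ℕ} {μ : ℝ} (hμ : 0 ≤ μ) (x : Space N) : 0 ≤ damping μ x :=
  div_nonneg hμ (bracket_pos x).le

theorem damping_le {N : ℕ} {μ : ℝ} (hμ : 0 ≤ μ) (x : Space N) : damping μ x ≤ μ :=
  div_le_self hμ (one_le_bracket x)

theorem isTestFunction_mul {N : ℕ} {T : ℝ≥0∞} {T' : ℝ} (hT : ENNReal.ofReal T' < T)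
    {k : ℝ → ℝ} (hk : ContDiff ℝ ∞ k) (hkT : ∀ t, T' ≤ t → k t = 0)
    {Φ : Space N → ℝ} (hΦ : ContDiff ℝ ∞ Φ) (hc : HasCompactSupport Φ) :
    IsTestFunction N T fun z => k z.1 * Φ z.2 := by
  have h : ContDiff ℝ ∞ fun z : ℝ × Space N => k z.1 * Φ z.2 :=
    (hk.comp contDiff_fst).mul (hΦ.comp contDiff_snd)
  have h1 := contDiff_infty.1 h 1
  refine ⟨ContDiff.contDiffOn (by exact_mod_cast h1), h.contDiffOn,
    Icc 0 T' ×ˢ tsupport Φ, isCompact_Icc.prod hc,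
    prod_mono (Icc_subset_timeIco hT) (subset_univ _), fun z hz hzK => ?_⟩
  by_cases hzT : T' ≤ z.1
  · simp [hkT _ hzT]
  · have : z.2 ∉ tsupport Φ := fun h => hzK ⟨⟨hz.1.1, (not_le.1 hzT).le⟩, h⟩
    simp [image_eq_zero_of_notMem_tsupport this]

/-- The energy identity for the test function `η(t) e^{-t} Φ(x)`, after the term with `u` has been
integrated in time and the nonlinear term has absorbed the right-hand side. -/
theorem energy_inequality_of_test {N : ℕ} {R μ p q ε : ℝ} (hμ : 0 ≤ μ) (hpq : p.HolderConjugate q)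
    {f : H1 N} {g : L2 N} {T : ℝ≥0∞} {u : ℝ → H1 N}
    (h : IsEnergySolution μ p ε f g T u) (hs : SupportedInCone R T u)
    {T' : ℝ} (hT0 : 0 < T') (hT : ENNReal.ofReal T' < T)
    {η : ℝ → ℝ} (hη : ContDiff ℝ ∞ η) (hη0 : η 0 = 1) (hηT : ∀ t, T' ≤ t → η t = 0)
    (hηnn : ∀ t, 0 ≤ η t) (hη1 : ∀ t, η t ≤ 1)
    (hη' : ∀ t ∈ Icc 0 T', deriv η t ≤ 0) {b m : ℝ → ℝ} (hb : ContinuousOn b (Icc 0 T'))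
    (hb0 : ∀ t ∈ Icc 0 T', 0 ≤ b t) (hm : ContinuousOn m (Icc 0 T'))
    (hQ : ∀ t ∈ Icc 0 T', -deriv η t +
      (1 + μ) * (Real.exp t * ∫ s in t..T', -deriv η s * Real.exp (-s)) ≤ b t * η t ^ (1 / p))
    {Φ : Space N → ℝ} (hΦ : ContDiff ℝ ∞ Φ) (hc : HasCompactSupport Φ) (hΦ0 : ∀ x, 0 ≤ Φ x)
    (hΦm : ∀ t ∈ Icc 0 T', ∫ x in Metric.closedBall (0 : Space N) (R + t), Φ x ≤ m t)
    {κ : ℝ} (hκ : ∀ t ∈ Icc 0 T',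
      |∫ x, fn (u t) x * (Δ Φ x - (1 + damping μ x) * Φ x)| ≤ κ) :
    ε * ((∫ x, g x * Φ x) + (1 - ∫ s in (0 : ℝ)..T', -deriv η s * Real.exp (-s)) *
        ∫ x, fn f x * ((1 + damping μ x) * Φ x)) ≤
      (∫ t in (0 : ℝ)..T', b t ^ q * Real.exp (-t) * m t) + T' * κ := by
  obtain ⟨-, huc, hu0, v, hv, hvc, -, htest⟩ := h
  have hIcc := Icc_subset_timeIco hT
  have hp0 : 0 < p := hpq.pos
  -- the time factor and its primitive
  set k : ℝ → ℝ := fun t => η t * Real.exp (-t) with hk_def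
  have hkC : ContDiff ℝ ∞ k := hη.mul (Real.contDiff_exp.comp contDiff_neg)
  have hkT : ∀ t, T' ≤ t → k t = 0 := fun t ht => by simp [k, hηT t ht]
  have hk0 : ∀ t, 0 ≤ k t := fun t => mul_nonneg (hηnn t) (Real.exp_nonneg _)
  have hdη : ∀ t, HasDerivAt η (deriv η t) t := fun t =>
    (hη.differentiable (by simp) t).hasDerivAt
  have hdηc : Continuous (deriv η) := hη.continuous_deriv (by simp)
  have hexp : ∀ t : ℝ, HasDerivAt (fun s => Real.exp (-s)) (-Real.exp (-t)) t := fun t => by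
    simpa using (hasDerivAt_neg t).exp
  have hk' : ∀ t, HasDerivAt k ((deriv η t - η t) * Real.exp (-t)) t := fun t =>
    ((hdη t).mul (hexp t)).congr_deriv (by ring)
  have hk'T : ∀ t, T' < t → deriv k t = 0 := fun t ht => by
    have : k =ᶠ[𝓝 t] fun _ => (0 : ℝ) := by
      filter_upwards [Ioi_mem_nhds ht] with s hs
      exact hkT s (le_of_lt hs)
    rw [this.deriv_eq]; simp
  have hθc : Continuous fun s => -deriv η s * Real.exp (-s) := by fun_prop
  set Θ : ℝ → ℝ := fun t => ∫ s in t..T', -deriv η s * Real.exp (-s) with hΘ_def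
  have hΘ : ∀ t, HasDerivAt Θ (deriv η t * Real.exp (-t)) t := fun t => by
    refine (intervalIntegral.integral_hasDerivAt_left (hθc.intervalIntegrable _ _)
      (hθc.stronglyMeasurableAtFilter _ _) hθc.continuousAt).congr_deriv ?_
    ring
  -- An explicit form of the primitive of -k that vanishes at T': since k' = (η' - η)e^{-t},
  -- subtracting Θ cancels the part with η'.
  set K : ℝ → ℝ := fun t => k t - Θ t with hK_def
  have hK : ∀ t, HasDerivAt K (-k t) t := fun t =>
    ((hk' t).sub (hΘ t)).congr_deriv (by simp only [k]; ring)
  have hKT : K T' = 0 := by simp [K, Θ, hkT T' le_rfl]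
  have hΘ0 : ∀ t ∈ Icc 0 T', 0 ≤ Θ t := fun t ht =>
    intervalIntegral.integral_nonneg ht.2 fun s hs =>
      mul_nonneg (neg_nonneg.2 (hη' s ⟨ht.1.trans hs.1, hs.2⟩)) (Real.exp_nonneg _)
  -- the space factors
  have hV := continuous_damping (N := N) μ
  have hΦ2 : ContDiff ℝ 2 Φ := by exact_mod_cast contDiff_infty.1 hΦ 2
  have hmem : ∀ {χ : Space N → ℝ}, Continuous χ → HasCompactSupport χ →
      MemLp χ 2 (volume : Measure (Space N)) := fun h1 h2 => h1.memLp_of_hasCompactSupport h2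
  have cΔ := continuous_laplacian hΦ2
  have sΔ : HasCompactSupport (Δ Φ) := hasCompactSupport_laplacian hc
  have w2 : Continuous fun x => damping μ x * Φ x := hV.mul hΦ.continuous
  have w3 : Continuous fun x => (1 + damping μ x) * Φ x :=
    (continuous_const.add hV).mul hΦ.continuous
  have w4 : Continuous fun x => Δ Φ x - (1 + damping μ x) * Φ x := cΔ.sub w3
  have s2 : HasCompactSupport fun x => damping μ x * Φ x := hc.mul_left
  have s3 : HasCompactSupport fun x => (1 + damping μ x) * Φ x := hc.mul_left
  have s4 : HasCompactSupport fun x => Δ Φ x - (1 + damping μ x) * Φ x := sΔ.sub s3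
  have M1 := hmem hΦ.continuous hc
  have M2 := hmem w2 s2
  have M3 := hmem w3 s3
  have M4 := hmem w4 s4
  have hvI : ContinuousOn v (Icc 0 T') := hvc.mono hIcc
  have huI : ContinuousOn (fun t => fn (u t)) (Icc 0 T') := fun t ht =>
    ((hv t (hIcc ht)).continuousWithinAt).mono hIcc
  have c1 : ContinuousOn (fun t => pairing M1 (v t)) (Icc 0 T') :=
    (pairing M1).continuous.comp_continuousOn hvI
  have c2 : ContinuousOn (fun t => pairing M2 (v t)) (Icc 0 T') :=
    (pairing M2).continuous.comp_continuousOn hvI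
  have c3 : ContinuousOn (fun t => pairing M3 (v t)) (Icc 0 T') :=
    (pairing M3).continuous.comp_continuousOn hvI
  have c3u : ContinuousOn (fun t => pairing M3 (fn (u t))) (Icc 0 T') :=
    (pairing M3).continuous.comp_continuousOn huI
  have c4 : ContinuousOn (fun t => pairing M4 (fn (u t))) (Icc 0 T') :=
    (pairing M4).continuous.comp_continuousOn huI
  have ck : Continuous k := hkC.continuous
  have ck' : Continuous (deriv k) := hkC.continuous_deriv (by simp)
  have cK : Continuous K := continuous_iff_continuousAt.2 fun t => (hK t).continuousAt
  have ii : ∀ {w : ℝ → ℝ}, ContinuousOn w (Icc 0 T') → IntervalIntegrable w volume 0 T' :=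
    fun hw => hw.intervalIntegrable_of_Icc hT0.le
  -- integration in time of the term containing `u`
  have hparts : ∫ t in (0 : ℝ)..T', (-k t * pairing M3 (fn (u t)) + K t * pairing M3 (v t)) =
      -(K 0 * pairing M3 (fn (u 0))) := by
    rw [intervalIntegral.integral_eq_sub_of_hasDerivAt_of_le
      (f := fun t => K t * pairing M3 (fn (u t))) hT0.le (cK.continuousOn.mul c3u), hKT]
    · ring
    · intro t ht
      have hnh : timeIco T ∈ 𝓝 t := mem_of_superset (Icc_mem_nhds ht.1 ht.2) hIcc
      exact (hK t).mul ((pairing M3).hasFDerivAt.comp_hasDerivAt t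
        ((hv t (hIcc ⟨ht.1.le, ht.2.le⟩)).hasDerivAt hnh))
    · exact ii ((ck.neg.continuousOn.mul c3u).add (cK.continuousOn.mul c3))
  -- the energy identity
  obtain ⟨hfin, hid⟩ := htest _ (isTestFunction_mul hT hkC hkT hΦ hc)
  simp only at hfin hid
  have t1 : ∫ x, g x * (k 0 * Φ x) = ∫ x, g x * Φ x := by simp [k, hη0]
  set J : ℝ → ℝ := fun t => ∫ x, |v t x| ^ p * (k t * Φ x) with hJ
  have t2 : ∫ t in timeIoo T, J t = ∫ t in (0 : ℝ)..T', J t :=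
    setIntegral_timeIoo hT0.le hT fun t ht => by simp [J, hkT t ht.le]
  have t3 : (∫ t in timeIoo T, ∫ x, -(v t x * deriv (fun s => k s * Φ x) t)) =
      ∫ t in (0 : ℝ)..T', -(deriv k t * pairing M1 (v t)) := by
    have : ∀ t, ∫ x, -(v t x * deriv (fun s => k s * Φ x) t) = -(deriv k t * pairing M1 (v t)) := by
      intro t
      rw [pairing_apply, integral_neg, ← integral_const_mul]
      congr 2
      ext x
      rw [deriv_mul_const (hk' t).differentiableAt]
      ring
    simp_rw [this]
    exact setIntegral_timeIoo hT0.le hT fun t ht => by simp [hk'T t ht]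
  have t4 : (∫ t in timeIoo T, ∫ x, inner ℝ (grad (u t) x) (∇ (fun y => k t * Φ y) x)) =
      ∫ t in (0 : ℝ)..T', -k t * (pairing M3 (fn (u t)) + pairing M4 (fn (u t))) := by
    have : ∀ t, ∫ x, inner ℝ (grad (u t) x) (∇ (fun y => k t * Φ y) x) =
        -k t * (pairing M3 (fn (u t)) + pairing M4 (fn (u t))) := by
      intro t
      have e1 : ∀ x, ∇ (fun y => k t * Φ y) x = k t • ∇ Φ x := fun x => by
        rw [gradient, gradient, fderiv_const_mul (hΦ2.differentiable (by norm_num) x), map_smul]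
      simp_rw [e1, real_inner_smul_right]
      rw [integral_const_mul, integral_inner_grad (u t) hΦ hc, pairing_apply, pairing_apply,
        ← integral_add (integrable_L2_mul _ w3 s3) (integrable_L2_mul _ w4 s4)]
      rw [mul_neg, neg_mul]
      congr 3
      ext x
      ring
    simp_rw [this]
    exact setIntegral_timeIoo hT0.le hT fun t ht => by simp [hkT t ht.le]
  have t5 : (∫ t in timeIoo T, ∫ x, damping μ x * v t x * (k t * Φ x)) =
      ∫ t in (0 : ℝ)..T', k t * pairing M2 (v t) := by
    have : ∀ t, ∫ x, damping μ x * v t x * (k t * Φ x) = k t * pairing M2 (v t) := by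
      intro t
      rw [pairing_apply, ← integral_const_mul]
      congr 1
      ext x
      ring
    simp_rw [this]
    exact setIntegral_timeIoo hT0.le hT fun t ht => by simp [hkT t ht.le]
  rw [t1, t2, t3, t4, t5] at hid
  have hfu0 : pairing M3 (fn (u 0)) = ε * ∫ x, fn f x * ((1 + damping μ x) * Φ x) := by
    rw [hu0, ← pairing_apply M3 (fn f), show fn (ε • f) = ε • fn f from rfl, map_smul, smul_eq_mul]
  have hK0 : K 0 = 1 - Θ 0 := by simp [K, k, hη0]
  -- All terms paired with ∂ₜu, including the one produced by the integration by parts. The pairing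
  -- with `M4` is the defect ΔΦ - (1+V)Φ, due to Φ being only an approximate solution.
  set G : ℝ → ℝ := fun t => -(deriv k t * pairing M1 (v t)) + k t * pairing M2 (v t) -
    K t * pairing M3 (v t) with hG
  have cG : ContinuousOn G (Icc 0 T') :=
    ((ck'.continuousOn.mul c1).neg.add (ck.continuousOn.mul c2)).sub (cK.continuousOn.mul c3)
  have hsum : (∫ t in (0 : ℝ)..T', -(deriv k t * pairing M1 (v t))) +
      (∫ t in (0 : ℝ)..T', -k t * (pairing M3 (fn (u t)) + pairing M4 (fn (u t)))) +
      (∫ t in (0 : ℝ)..T', k t * pairing M2 (v t)) =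
      (∫ t in (0 : ℝ)..T', G t) + (∫ t in (0 : ℝ)..T', -k t * pairing M4 (fn (u t))) +
      ∫ t in (0 : ℝ)..T', (-k t * pairing M3 (fn (u t)) + K t * pairing M3 (v t)) := by
    have i1 : IntervalIntegrable (fun t => -(deriv k t * pairing M1 (v t))) volume 0 T' :=
      ii (ck'.continuousOn.mul c1).neg
    have i2 : IntervalIntegrable (fun t => -k t * (pairing M3 (fn (u t)) + pairing M4 (fn (u t))))
      volume 0 T' := ii (ck.neg.continuousOn.mul (c3u.add c4))
    have i3 : IntervalIntegrable (fun t => k t * pairing M2 (v t)) volume 0 T' :=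
      ii (ck.continuousOn.mul c2)
    have i4 : IntervalIntegrable (fun t => -k t * pairing M4 (fn (u t))) volume 0 T' :=
      ii (ck.neg.continuousOn.mul c4)
    have i5 : IntervalIntegrable (fun t => -k t * pairing M3 (fn (u t)) + K t * pairing M3 (v t))
      volume 0 T' := ii ((ck.neg.continuousOn.mul c3u).add (cK.continuousOn.mul c3))
    have i12 : IntervalIntegrable (fun t => -(deriv k t * pairing M1 (v t)) +
      -k t * (pairing M3 (fn (u t)) + pairing M4 (fn (u t)))) volume 0 T' := i1.add i2
    have i14 : IntervalIntegrable (fun t => G t + -k t * pairing M4 (fn (u t))) volume 0 T' :=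
      (ii cG).add i4
    rw [← intervalIntegral.integral_add i1 i2, ← intervalIntegral.integral_add i12 i3,
      ← intervalIntegral.integral_add (ii cG) i4,
      ← intervalIntegral.integral_add i14 i5]
    congr 1
    ext t
    simp only [G]
    ring
  have hlhs : ε * ((∫ x, g x * Φ x) + (1 - Θ 0) * ∫ x, fn f x * ((1 + damping μ x) * Φ x)) +
      ∫ t in (0 : ℝ)..T', J t =
      (∫ t in (0 : ℝ)..T', G t) + ∫ t in (0 : ℝ)..T', -k t * pairing M4 (fn (u t)) := by
    rw [hsum, hparts, hfu0, hK0] at hid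
    linarith
  -- integrability of the nonlinear term
  set L : ℝ → ℝ≥0∞ := fun t => ∫⁻ x, ‖|v t x| ^ p * (k t * Φ x)‖ₑ with hL
  have hLm : AEMeasurable L (volume.restrict (Ioc 0 T')) := by
    have : L = fun t => ‖k t‖ₑ * ∫⁻ x, ‖|v t x| ^ p * Φ x‖ₑ := by
      ext t
      rw [← lintegral_const_mul' _ _ enorm_ne_top]
      refine lintegral_congr fun x => ?_
      rw [← enorm_mul]
      ring_nf
    rw [this]
    exact ck.enorm.measurable.aemeasurable.mul (aemeasurable_lintegral_rpow hp0.le hΦ.continuous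
      measurableSet_Ioc (hvI.mono Ioc_subset_Icc_self))
  have hLfin : ∫⁻ t in Ioc 0 T', L t < ⊤ :=
    (lintegral_mono_set (Ioc_subset_timeIoo hT)).trans_lt hfin
  have hmeasx : ∀ t, AEStronglyMeasurable (fun x => |v t x| ^ p * (k t * Φ x)) volume := fun t =>
    (((Real.continuous_rpow_const hp0.le).comp continuous_abs).comp_aestronglyMeasurable
      (Lp.aestronglyMeasurable _)).mul (continuous_const.mul hΦ.continuous).aestronglyMeasurable
  -- This also holds where L t = ∞, both sides being 0 there. Integrability of J in time thus
  -- follows from the measurability and finite integral of L.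
  have hJL : J = fun t => (L t).toReal := by
    ext t
    rw [hJ, hL]
    simp only
    rw [integral_eq_lintegral_of_nonneg_ae (Eventually.of_forall fun x => ?_) (hmeasx t)]
    · congr 1
      refine lintegral_congr fun x => ?_
      rw [Real.enorm_eq_ofReal (mul_nonneg (by positivity) (mul_nonneg (hk0 t) (hΦ0 x)))]
    · exact mul_nonneg (by positivity) (mul_nonneg (hk0 t) (hΦ0 x))
  have hJint : IntegrableOn J (Ioc 0 T') := by
    rw [hJL]
    exact integrable_toReal_of_lintegral_ne_top hLm hLfin.ne
  have hLae : ∀ᵐ t ∂volume.restrict (Ioc 0 T'), L t < ⊤ := ae_lt_top' hLm hLfin.ne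
  -- absorption into the nonlinear term
  have cb : ContinuousOn (fun t => b t ^ q * Real.exp (-t)) (Icc 0 T') :=
    (hb.rpow_const fun t _ => Or.inr hpq.symm.nonneg).mul (by fun_prop)
  have hGle : ∀ᵐ t ∂volume.restrict (Ioc 0 T'), G t ≤ J t + b t ^ q * Real.exp (-t) * m t := by
    filter_upwards [hLae, ae_restrict_mem measurableSet_Ioc] with t hLt ht
    have htI : t ∈ Icc 0 T' := ⟨ht.1.le, ht.2⟩
    have hsupp := deriv_supported hv hs (hIcc htI) ht.1
    have hJx : Integrable fun x => |v t x| ^ p * (k t * Φ x) := ⟨hmeasx t, hLt⟩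
    have hβ : 0 ≤ b t ^ q * Real.exp (-t) :=
      mul_nonneg (Real.rpow_nonneg (hb0 t htI) _) (Real.exp_nonneg _)
    set Ball := Metric.closedBall (0 : Space N) (R + t) with hBall
    have hBm : MeasurableSet Ball := Metric.isClosed_closedBall.measurableSet
    have hΦi : Integrable fun x => Ball.indicator Φ x :=
      (hΦ.continuous.integrable_of_hasCompactSupport hc).indicator hBm
    have hGeq : G t = ∫ x, v t x * ((-deriv k t + damping μ x * k t -
        (1 + damping μ x) * K t) * Φ x) := by
      have j1 := (integrable_L2_mul (v t) hΦ.continuous hc).const_mul (-deriv k t)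
      have j2 := (integrable_L2_mul (v t) w2 s2).const_mul (k t)
      have j3 := (integrable_L2_mul (v t) w3 s3).const_mul (K t)
      simp only [G]
      have j12 : Integrable fun x => -deriv k t * (v t x * Φ x) +
        k t * (v t x * (damping μ x * Φ x)) := j1.add j2
      rw [pairing_apply, pairing_apply, pairing_apply, ← neg_mul, ← integral_const_mul,
        ← integral_const_mul, ← integral_const_mul, ← integral_add j1 j2,
        ← integral_sub j12 j3]
      congr 1
      ext x
      ring
    have hJB : Integrable fun x => |v t x| ^ p * (k t * Φ x) +
        b t ^ q * Real.exp (-t) * Ball.indicator Φ x := hJx.add (hΦi.const_mul _)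
    have hle : G t ≤ ∫ x, (|v t x| ^ p * (k t * Φ x) +
        b t ^ q * Real.exp (-t) * Ball.indicator Φ x) := by
      rw [hGeq]
      refine integral_mono_ae ?_ hJB ?_
      · have hcont : Continuous fun x => (-deriv k t + damping μ x * k t -
            (1 + damping μ x) * K t) * Φ x := by fun_prop
        exact integrable_L2_mul (v t) hcont hc.mul_left
      · filter_upwards [hsupp] with x hx
        by_cases hxB : x ∈ Ball
        · rw [indicator_of_mem hxB]
          have hV0 := damping_nonneg hμ x
          have hVμ := damping_le hμ x
          -- The adjoint equation at work: the terms in η without derivative, with coefficients 1, V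
          -- and -(1+V), cancel.
          have hQx : -deriv k t + damping μ x * k t - (1 + damping μ x) * K t =
              (-deriv η t + (1 + damping μ x) * (Real.exp t * Θ t)) * Real.exp (-t) := by
            rw [(hk' t).deriv]
            have : Real.exp t * Real.exp (-t) = 1 := by rw [← Real.exp_add]; simp
            simp only [K, k]
            linear_combination (-(1 + damping μ x) * Θ t) * this
          have hE : 0 ≤ Real.exp t * Θ t := mul_nonneg (Real.exp_nonneg _) (hΘ0 t htI)
          have hQ0 : 0 ≤ -deriv η t + (1 + damping μ x) * (Real.exp t * Θ t) :=
            add_nonneg (neg_nonneg.2 (hη' t htI)) (by positivity)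
          have hQ1 : -deriv η t + (1 + damping μ x) * (Real.exp t * Θ t) ≤
              b t * η t ^ (1 / p) := by
            refine le_trans ?_ (hQ t htI)
            gcongr
          -- The factors are |∂ₜu| η^{1/p} and b. The power 1/p makes the first one contribute
          -- exactly |∂ₜu|^p η, and the gains 1/p and 1/q are discarded.
          have hyoung := Real.young_inequality_of_nonneg
            (mul_nonneg (abs_nonneg (v t x)) (Real.rpow_nonneg (hηnn t) (1 / p))) (hb0 t htI) hpq
          rw [Real.mul_rpow (abs_nonneg _) (Real.rpow_nonneg (hηnn t) _), ← Real.rpow_mul (hηnn t),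
            one_div_mul_cancel hp0.ne', Real.rpow_one] at hyoung
          have hy1 : |v t x| ^ p * η t / p ≤ |v t x| ^ p * η t :=
            div_le_self (mul_nonneg (by positivity) (hηnn t)) hpq.lt.le
          have hy2 : b t ^ q / q ≤ b t ^ q :=
            div_le_self (Real.rpow_nonneg (hb0 t htI) _) hpq.symm.lt.le
          have hw : v t x * (-deriv η t + (1 + damping μ x) * (Real.exp t * Θ t)) ≤
              |v t x| ^ p * η t + b t ^ q :=
            calc _ ≤ |v t x| * (-deriv η t + (1 + damping μ x) * (Real.exp t * Θ t)) :=
                  mul_le_mul_of_nonneg_right (le_abs_self _) hQ0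
              _ ≤ |v t x| * (b t * η t ^ (1 / p)) :=
                  mul_le_mul_of_nonneg_left hQ1 (abs_nonneg _)
              _ = |v t x| * η t ^ (1 / p) * b t := by ring
              _ ≤ _ := by linarith
          have hfac : 0 ≤ Real.exp (-t) * Φ x := mul_nonneg (Real.exp_nonneg _) (hΦ0 x)
          have := mul_le_mul_of_nonneg_right hw hfac
          rw [hQx]
          simp only [k]
          linarith
        · have hxR : R + t < ‖x‖ := by simpa [hBall] using hxB
          rw [indicator_of_notMem hxB, hx hxR]
          simp [Real.zero_rpow hp0.ne']
    refine hle.trans ?_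
    rw [integral_add hJx (hΦi.const_mul _), integral_const_mul, integral_indicator hBm]
    have := mul_le_mul_of_nonneg_left (hΦm t htI) hβ
    linarith
  have hGint : ∫ t in (0 : ℝ)..T', G t ≤
      (∫ t in (0 : ℝ)..T', J t) + ∫ t in (0 : ℝ)..T', b t ^ q * Real.exp (-t) * m t := by
    have i1 : IntervalIntegrable J volume 0 T' :=
      (intervalIntegrable_iff_integrableOn_Ioc_of_le hT0.le).2 hJint
    have i2 : IntervalIntegrable (fun t => b t ^ q * Real.exp (-t) * m t) volume 0 T' :=
      ii (cb.mul hm)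
    rw [← intervalIntegral.integral_add i1 i2, intervalIntegral.integral_of_le hT0.le,
      intervalIntegral.integral_of_le hT0.le]
    exact integral_mono_ae (ii cG).1 (i1.add i2).1 hGle
  have herr : ∫ t in (0 : ℝ)..T', -k t * pairing M4 (fn (u t)) ≤ T' * κ := by
    have hκ0 : 0 ≤ κ := (abs_nonneg _).trans (hκ 0 ⟨le_rfl, hT0.le⟩)
    have : ∫ t in (0 : ℝ)..T', -k t * pairing M4 (fn (u t)) ≤ ∫ _ in (0 : ℝ)..T', κ := by
      refine intervalIntegral.integral_mono_on hT0.le (ii (ck.neg.continuousOn.mul c4))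
        (by simp) fun t ht => ?_
      have h1 := hκ t ht
      rw [← pairing_apply M4] at h1
      have h2 : k t ≤ 1 := mul_le_one₀ (hη1 t) (Real.exp_nonneg _) (by simpa using ht.1)
      calc -k t * pairing M4 (fn (u t)) ≤ |-k t * pairing M4 (fn (u t))| := le_abs_self _
        _ = k t * |pairing M4 (fn (u t))| := by rw [abs_mul, abs_neg, abs_of_nonneg (hk0 t)]
        _ ≤ 1 * κ := by gcongr
        _ = κ := one_mul _
    simpa using this
  linarith

theorem integrable_mul_of_supported {N : ℕ} (w : L2 N) {r : ℝ} {h : Space N → ℝ}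
    (hw : ∀ᵐ x : Space N, r < ‖x‖ → w x = 0) (hh : Continuous h) :
    Integrable fun x => w x * h x := by
  have hfin : volume (Metric.closedBall (0 : Space N) r) ≠ ⊤ := measure_closedBall_lt_top.ne
  have hint : IntegrableOn (fun x => w x) (Metric.closedBall (0 : Space N) r) := by
    have : IsFiniteMeasure (volume.restrict (Metric.closedBall (0 : Space N) r)) :=
      ⟨by simpa using hfin.lt_top⟩
    exact ((Lp.memLp w).restrict _).integrable (by norm_num)
  have h1 : IntegrableOn (fun x => w x * h x) (Metric.closedBall (0 : Space N) r) :=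
    hint.mul_continuousOn hh.continuousOn (isCompact_closedBall _ _)
  refine (h1.integrable_indicator Metric.isClosed_closedBall.measurableSet).congr ?_
  filter_upwards [hw] with x hx
  by_cases hxr : ‖x‖ ≤ r
  · rw [indicator_of_mem (by simpa using hxr)]
  · rw [indicator_of_notMem (by simpa using hxr), hx (not_le.1 hxr), zero_mul]

/-- The key integral inequality for solutions supported in the cone. -/
theorem energy_inequality {N : ℕ} {R μ p q ε : ℝ} (hμ : 0 ≤ μ) (hpq : p.HolderConjugate q)
    (hε : 0 < ε) {φ : Space N → ℝ} (hφ : ContDiff ℝ 2 φ) (hφ_pos : ∀ x, 0 < φ x)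
    (hφ_eq : ∀ x, Δ φ x = (1 + damping μ x) * φ x)
    {f : H1 N} {g : L2 N} (hf : ∀ᵐ x : Space N, R < ‖x‖ → fn f x = 0)
    (hg : ∀ᵐ x : Space N, R < ‖x‖ → g x = 0) {T : ℝ≥0∞} {u : ℝ → H1 N}
    (h : IsEnergySolution μ p ε f g T u) (hs : SupportedInCone R T u)
    {T' : ℝ} (hT0 : 0 < T') (hT : ENNReal.ofReal T' < T)
    {η : ℝ → ℝ} (hη : ContDiff ℝ ∞ η) (hη0 : η 0 = 1) (hηT : ∀ t, T' ≤ t → η t = 0)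
    (hηnn : ∀ t, 0 ≤ η t) (hη1 : ∀ t, η t ≤ 1)
    (hη' : ∀ t ∈ Icc 0 T', deriv η t ≤ 0) {b m : ℝ → ℝ} (hb : ContinuousOn b (Icc 0 T'))
    (hb0 : ∀ t ∈ Icc 0 T', 0 ≤ b t) (hm : ContinuousOn m (Icc 0 T'))
    (hQ : ∀ t ∈ Icc 0 T', -deriv η t +
      (1 + μ) * (Real.exp t * ∫ s in t..T', -deriv η s * Real.exp (-s)) ≤ b t * η t ^ (1 / p))
    (hφm : ∀ t ∈ Icc 0 T', ∫ x in Metric.closedBall (0 : Space N) (R + t), φ x ≤ m t) :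
    ε * ((∫ x, g x * φ x) + (1 - ∫ s in (0 : ℝ)..T', -deriv η s * Real.exp (-s)) *
        ∫ x, fn f x * ((1 + damping μ x) * φ x)) ≤
      ∫ t in (0 : ℝ)..T', b t ^ q * Real.exp (-t) * m t := by
  set ρ : ℝ := R + T' with hρ
  set vol : ℝ := volume.real (Metric.closedBall (0 : Space N) ρ) with hvol
  have hvol0 : 0 ≤ vol := measureReal_nonneg
  set θ : ℝ := 1 - ∫ s in (0 : ℝ)..T', -deriv η s * Real.exp (-s) with hθ
  have hV := continuous_damping (N := N) μ
  have hIcc := Icc_subset_timeIco hT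
  -- A bound for the solution on the compact interval [0, T'] makes the defect of Φ small uniformly
  -- in time. It may depend on u and T', because it disappears with δ → 0.
  obtain ⟨B, hB⟩ : ∃ B, ∀ t ∈ Icc 0 T', ‖fn (u t)‖ ^ 2 ≤ B := by
    have hc : ContinuousOn (fun t => ‖fn (u t)‖ ^ 2) (Icc 0 T') := by
      obtain ⟨-, huc, -⟩ := h
      have : Continuous (fun w : H1 N => fn w) := continuous_fst.comp continuous_subtype_val
      exact ((this.comp_continuousOn (huc.mono hIcc)).norm).pow 2
    obtain ⟨B, hB⟩ := isCompact_Icc.bddAbove_image hc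
    exact ⟨B, fun t ht => hB ⟨t, ht, rfl⟩⟩
  have hB0 : 0 ≤ B := (sq_nonneg _).trans (hB 0 ⟨le_rfl, hT0.le⟩)
  have far : ∀ {w : L2 N} {r r' : ℝ}, r ≤ r' → (∀ᵐ x : Space N, r < ‖x‖ → w x = 0) →
      ∀ᵐ x : Space N, r' < ‖x‖ → w x = 0 := fun hr hw => by
    filter_upwards [hw] with x hx hx'
    exact hx (hr.trans_lt hx')
  have hfρ := far (by linarith : R ≤ ρ) hf
  have hgρ := far (by linarith : R ≤ ρ) hg
  have cb : ContinuousOn (fun t => b t ^ q * Real.exp (-t)) (Icc 0 T') :=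
    (hb.rpow_const fun t _ => Or.inr hpq.symm.nonneg).mul (by fun_prop)
  have ib : IntervalIntegrable (fun t => b t ^ q * Real.exp (-t)) volume 0 T' :=
    cb.intervalIntegrable_of_Icc hT0.le
  have ibm : IntervalIntegrable (fun t => b t ^ q * Real.exp (-t) * m t) volume 0 T' :=
    (cb.mul hm).intervalIntegrable_of_Icc hT0.le
  set Ib : ℝ := ∫ t in (0 : ℝ)..T', b t ^ q * Real.exp (-t) with hIb
  have hIb0 : 0 ≤ Ib := intervalIntegral.integral_nonneg hT0.le fun t ht =>
    mul_nonneg (Real.rpow_nonneg (hb0 t ht) _) (Real.exp_nonneg _)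
  -- The total error per unit of δ: from g, from f, from the mass of Φ, and from the defect
  -- integrated over [0, T'].
  set C : ℝ := ε * (‖g‖ ^ 2 + vol) + ε * (|θ| * ((1 + μ) * (‖fn f‖ ^ 2 + vol))) + Ib * vol +
    T' * ((2 + μ) * (B + vol)) with hC
  have hC0 : 0 ≤ C := by positivity
  -- it suffices to prove the inequality up to an arbitrarily small error
  suffices key : ∀ δ : ℝ, 0 < δ → ε * ((∫ x, g x * φ x) + θ *
      ∫ x, fn f x * ((1 + damping μ x) * φ x)) ≤
      (∫ t in (0 : ℝ)..T', b t ^ q * Real.exp (-t) * m t) + C * δ by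
    refine le_of_forall_pos_le_add fun e he => ?_
    refine (key (e / (C + 1)) (by positivity)).trans ?_
    have : C * (e / (C + 1)) ≤ e := by
      rw [mul_div_assoc', div_le_iff₀ (by positivity)]
      nlinarith
    linarith
  intro δ hδ
  obtain ⟨Φ, hΦ, hc, hΦ0, happ⟩ := exists_smooth_approx hφ (fun x => (hφ_pos x).le) ρ hδ
  have hΦ2 : ContDiff ℝ 2 Φ := by exact_mod_cast contDiff_infty.1 hΦ 2
  have hVx : ∀ x : Space N, |1 + damping μ x| ≤ 1 + μ := fun x => by
    have h1 := damping_nonneg hμ x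
    have h2 := damping_le hμ x
    rw [abs_of_nonneg (by linarith)]
    linarith
  have hVd : ∀ x : Space N, ‖x‖ ≤ ρ → |(1 + damping μ x) * Φ x - (1 + damping μ x) * φ x| ≤
      (1 + μ) * δ := fun x hx => by
    rw [← mul_sub, abs_mul]
    exact mul_le_mul (hVx x) (happ x hx).1 (abs_nonneg _) (by linarith)
  have e1 : |∫ x, g x * (Φ x - φ x)| ≤ δ * (‖g‖ ^ 2 + vol) :=
    abs_integral_mul_le g hδ.le hgρ fun x hx => (happ x hx).1
  have e2 : |∫ x, fn f x * ((1 + damping μ x) * Φ x - (1 + damping μ x) * φ x)| ≤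
      (1 + μ) * δ * (‖fn f‖ ^ 2 + vol) :=
    abs_integral_mul_le (fn f) (by positivity) hfρ hVd
  have e1' : ∫ x, g x * (Φ x - φ x) = (∫ x, g x * Φ x) - ∫ x, g x * φ x := by
    simp_rw [mul_sub]
    exact integral_sub (integrable_mul_of_supported g hg hΦ.continuous)
      (integrable_mul_of_supported g hg hφ.continuous)
  have e2' : ∫ x, fn f x * ((1 + damping μ x) * Φ x - (1 + damping μ x) * φ x) =
      (∫ x, fn f x * ((1 + damping μ x) * Φ x)) - ∫ x, fn f x * ((1 + damping μ x) * φ x) := by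
    simp_rw [mul_sub]
    exact integral_sub
      (integrable_mul_of_supported (fn f) hf ((continuous_const.add hV).mul hΦ.continuous))
      (integrable_mul_of_supported (fn f) hf ((continuous_const.add hV).mul hφ.continuous))
  have hκ : ∀ t ∈ Icc 0 T', |∫ x, fn (u t) x * (Δ Φ x - (1 + damping μ x) * Φ x)| ≤
      (2 + μ) * δ * (B + vol) := fun t ht => by
    refine (abs_integral_mul_le (r := ρ) (δ := (2 + μ) * δ) (fn (u t)) (by positivity)
      (far (by linarith [ht.2]) (hs t (hIcc ht))) fun x hx => ?_).trans ?_
    · have h1 := (happ x hx).2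
      have h2 := hVd x hx
      rw [hφ_eq] at h1
      calc |Δ Φ x - (1 + damping μ x) * Φ x|
          = |(Δ Φ x - (1 + damping μ x) * φ x) -
            ((1 + damping μ x) * Φ x - (1 + damping μ x) * φ x)| := by ring_nf
        _ ≤ _ := abs_sub _ _
        _ ≤ (2 + μ) * δ := by linarith
    · have := hB t ht
      gcongr
  have hΦm : ∀ t ∈ Icc 0 T', ∫ x in Metric.closedBall (0 : Space N) (R + t), Φ x ≤
      m t + δ * vol := fun t ht => by
    have hsub : Metric.closedBall (0 : Space N) (R + t) ⊆ Metric.closedBall 0 ρ :=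
      Metric.closedBall_subset_closedBall (by linarith [ht.2])
    have i1 : IntegrableOn φ (Metric.closedBall (0 : Space N) (R + t)) :=
      hφ.continuous.continuousOn.integrableOn_compact (isCompact_closedBall _ _)
    have i2 : IntegrableOn Φ (Metric.closedBall (0 : Space N) (R + t)) :=
      hΦ.continuous.continuousOn.integrableOn_compact (isCompact_closedBall _ _)
    have i3 : IntegrableOn (fun _ : Space N => δ) (Metric.closedBall (0 : Space N) (R + t)) :=
      integrableOn_const measure_closedBall_lt_top.ne
    have h1 : ∫ x in Metric.closedBall (0 : Space N) (R + t), Φ x ≤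
        ∫ x in Metric.closedBall (0 : Space N) (R + t), (φ x + δ) := by
      refine setIntegral_mono_on i2 (i1.add i3) Metric.isClosed_closedBall.measurableSet
        fun x hx => ?_
      have := (abs_le.1 (happ x (by simpa using hsub hx)).1).2
      linarith
    rw [integral_add i1 i3, setIntegral_const, smul_eq_mul] at h1
    have h2 : volume.real (Metric.closedBall (0 : Space N) (R + t)) ≤ vol :=
      measureReal_mono hsub measure_closedBall_lt_top.ne
    have h3 := hφm t ht
    have h4 := mul_le_mul_of_nonneg_right h2 hδ.le
    linarith
  have main := energy_inequality_of_test hμ hpq h hs hT0 hT hη hη0 hηT hηnn hη1 hη' hb hb0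
    (m := fun t => m t + δ * vol) (hm.add continuousOn_const) hQ hΦ hc hΦ0 hΦm hκ
  have hrhs : ∫ t in (0 : ℝ)..T', b t ^ q * Real.exp (-t) * (m t + δ * vol) =
      (∫ t in (0 : ℝ)..T', b t ^ q * Real.exp (-t) * m t) + Ib * (δ * vol) := by
    simp_rw [mul_add]
    rw [intervalIntegral.integral_add ibm (ib.mul_const _), intervalIntegral.integral_mul_const]
  rw [hrhs, ← hθ] at main
  rw [e1'] at e1
  rw [e2'] at e2
  set A₁ := ∫ x, g x * Φ x
  set A₀ := ∫ x, g x * φ x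
  set B₁ := ∫ x, fn f x * ((1 + damping μ x) * Φ x)
  set B₀ := ∫ x, fn f x * ((1 + damping μ x) * φ x)
  have h1 : A₀ ≤ A₁ + δ * (‖g‖ ^ 2 + vol) := by linarith [(abs_le.1 e1).1]
  have h2 : θ * B₀ ≤ θ * B₁ + |θ| * ((1 + μ) * δ * (‖fn f‖ ^ 2 + vol)) := by
    have : |θ * (B₁ - B₀)| ≤ |θ| * ((1 + μ) * δ * (‖fn f‖ ^ 2 + vol)) := by
      rw [abs_mul]
      gcongr
    linarith [(abs_le.1 this).1]
  have h3 := mul_le_mul_of_nonneg_left (add_le_add h1 h2) hε.le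
  rw [hC]
  linarith

/-! ### Time cutoffs and the weighted inequality. -/

/-- A smooth decreasing cutoff whose derivative is controlled by a fractional power. -/
theorem exists_cutoff {p q : ℝ} (hpq : p.HolderConjugate q) :
    ∃ ζ : ℝ → ℝ, ∃ c : ℝ, 0 < c ∧ ContDiff ℝ ∞ ζ ∧ Antitone ζ ∧ ζ 0 = 1 ∧
      (∀ s, 1 ≤ s → ζ s = 0) ∧ (∀ s, 0 ≤ ζ s) ∧ (∀ s, ζ s ≤ 1) ∧
      ∀ s ∈ Icc (0 : ℝ) 1, -deriv ζ s ≤ c * ζ s ^ (1 / p) := by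
  -- For ζ = σⁿ the derivative carries σ^{n-1}, which is at most ζ^{1/p} = σ^{n/p} exactly because n
  -- ≥ q means n - 1 ≥ n/p; 0 ≤ σ ≤ 1 is used.
  obtain ⟨n, hn⟩ := exists_nat_ge (max q 2)
  have hnq : q ≤ n := (le_max_left _ _).trans hn
  have hn2 : (2 : ℝ) ≤ n := (le_max_right _ _).trans hn
  have hn2' : 2 ≤ n := by exact_mod_cast hn2
  let σ : ℝ → ℝ := fun s => Real.smoothTransition (1 - s)
  have hσ : ContDiff ℝ ∞ σ := Real.smoothTransition.contDiff.comp (contDiff_const.sub contDiff_id)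
  have hσ0 : ∀ s, 0 ≤ σ s := fun s => Real.smoothTransition.nonneg _
  have hσ1 : ∀ s, σ s ≤ 1 := fun s => Real.smoothTransition.le_one _
  have hσanti : Antitone σ := fun s t hst => Real.smoothTransition.monotone (by linarith)
  have hσd : ∀ s, HasDerivAt σ (deriv σ s) s := fun s =>
    (hσ.differentiable (by simp) s).hasDerivAt
  obtain ⟨c, hc⟩ := isCompact_Icc.exists_bound_of_continuousOn (s := Icc (0 : ℝ) 1)
    (hσ.continuous_deriv (by simp)).continuousOn
  have hc0 : 0 ≤ c := (norm_nonneg _).trans (hc 0 ⟨le_rfl, zero_le_one⟩)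
  refine ⟨fun s => σ s ^ n, n * c + 1, by positivity, hσ.pow n,
    fun s t hst => pow_le_pow_left₀ (hσ0 _) (hσanti hst) n, ?_, ?_, ?_, ?_, ?_⟩
  · simp [σ, Real.smoothTransition.one_of_one_le le_rfl]
  · intro s hs
    have : σ s = 0 := Real.smoothTransition.zero_of_nonpos (by linarith)
    simp [this]
    omega
  · exact fun s => pow_nonneg (hσ0 s) n
  · exact fun s => pow_le_one₀ (hσ0 s) (hσ1 s)
  · intro s hs
    have hd : deriv (fun s => σ s ^ n) s = n * σ s ^ (n - 1) * deriv σ s := ((hσd s).pow n).deriv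
    have hpow : σ s ^ (n - 1) ≤ (σ s ^ n) ^ (1 / p) := by
      rcases (hσ0 s).eq_or_lt with h0 | h0
      · rw [← h0, zero_pow (by omega)]
        positivity
      · rw [← Real.rpow_natCast, ← Real.rpow_natCast, ← Real.rpow_mul h0.le]
        refine Real.rpow_le_rpow_of_exponent_ge h0 (hσ1 s) ?_
        rw [Nat.cast_sub (by omega), Nat.cast_one]
        have h1 : 1 / p = 1 - 1 / q := by
          have := hpq.inv_add_inv_eq_one
          rw [one_div, one_div]
          linarith
        have h2 : 1 ≤ (n : ℝ) * (1 / q) := by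
          rw [mul_one_div, le_div_iff₀ hpq.symm.pos]
          linarith
        rw [h1]
        linarith
    have hb := hc s hs
    rw [Real.norm_eq_abs] at hb
    have hb' := (abs_le.1 hb).1
    have hY : 0 ≤ (σ s ^ n) ^ (1 / p) := by have := hσ0 s; positivity
    have h3 : 0 ≤ n * σ s ^ (n - 1) := by have := hσ0 s; positivity
    rw [hd]
    calc -(n * σ s ^ (n - 1) * deriv σ s) = n * σ s ^ (n - 1) * (-deriv σ s) := by ring
      _ ≤ n * σ s ^ (n - 1) * c := by gcongr; linarith
      _ ≤ n * (σ s ^ n) ^ (1 / p) * c := by gcongr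
      _ ≤ (n * c + 1) * (σ s ^ n) ^ (1 / p) := by linarith

/-- The integral inequality for the time cutoffs `ζ ∘ τ`, where `τ` increases from `0` to `1` on
`[0, T']` with speed at most `w`. -/
theorem exists_weighted_inequality {N : ℕ} (hN : 1 ≤ N) {R μ p q : ℝ} (hR : 0 ≤ R) (hμ : 0 ≤ μ)
    (hpq : p.HolderConjugate q) {φ : Space N → ℝ} (hφ : ContDiff ℝ 2 φ) (hφ_pos : ∀ x, 0 < φ x)
    (hφ_eq : ∀ x, Δ φ x = (1 + damping μ x) * φ x)
    {f : H1 N} {g : L2 N} (hf : ∀ᵐ x : Space N, R < ‖x‖ → fn f x = 0)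
    (hg : ∀ᵐ x : Space N, R < ‖x‖ → g x = 0) (hfg : 0 < dataPairing (fn f) g φ) :
    ∃ c : ℝ, 0 < c ∧ ∃ C : ℝ, 0 < C ∧ ∀ (ε : ℝ) (T : ℝ≥0∞) (u : ℝ → H1 N), 0 < ε →
      IsEnergySolution μ p ε f g T u → SupportedInCone R T u →
      ∀ T' : ℝ, 0 < T' → ENNReal.ofReal T' < T →
      ∀ τ τ' w : ℝ → ℝ, ContDiff ℝ ∞ τ → (∀ t, HasDerivAt τ (τ' t) t) → τ 0 = 0 →
        (∀ t, T' ≤ t → 1 ≤ τ t) → τ T' = 1 → (∀ t ∈ Icc 0 T', 0 ≤ τ' t ∧ τ' t ≤ w t) →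
        ContinuousOn w (Icc 0 T') → AntitoneOn w (Icc 0 T') → w 0 ≤ c →
        ε ≤ C * ∫ t in (0 : ℝ)..T', w t ^ q * (1 + t) ^ (((N : ℝ) - 1 + μ) / 2) := by
  obtain ⟨M, hM, hmass⟩ := exists_mass_bound hN hμ hφ hφ_pos hφ_eq
  obtain ⟨ζ, c, hc, hζ, hζanti, hζ0, hζ1, hζnn, hζle, hζd⟩ := exists_cutoff hpq
  set a : ℝ := ((N : ℝ) - 1 + μ) / 2 with ha
  have ha0 : 0 ≤ a := by
    have : (1 : ℝ) ≤ N := by exact_mod_cast hN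
    have : 0 ≤ (N : ℝ) - 1 + μ := by linarith
    positivity
  set A : ℝ := ∫ x, g x * φ x with hA
  set B : ℝ := ∫ x, fn f x * ((1 + damping μ x) * φ x) with hB
  have hAB : dataPairing (fn f) g φ = A + B := by
    rw [dataPairing, add_comm]
    simp_rw [hφ_eq]
    rfl
  set D := A + B with hD
  rw [hAB] at hfg
  set C₀ : ℝ := M * (Real.exp R * (1 + R) ^ a) with hC₀
  have hC₀pos : 0 < C₀ := by
    have : 0 < 1 + R := by linarith
    positivity
  have hβ : 0 < (2 + μ) * c := by positivity
  -- The threshold on w(0) is what makes Θ(0)·B at most half of the data pairing D, so the left side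
  -- stays at least εD/2.
  refine ⟨D / (2 * c * (|B| + 1)), by positivity, 2 / D * (((2 + μ) * c) ^ q * C₀),
    by positivity, ?_⟩
  intro ε T u hε h hs T' hT0 hT τ τ' w hτ hτd hτ0 hτge hτT hτw hwc hwanti hwle
  have h0mem : (0 : ℝ) ∈ Icc 0 T' := ⟨le_rfl, hT0.le⟩
  have hw0 : ∀ t ∈ Icc 0 T', 0 ≤ w t := fun t ht => (hτw t ht).1.trans (hτw t ht).2
  have hτmono : MonotoneOn τ (Icc 0 T') := by
    refine monotoneOn_of_deriv_nonneg (convex_Icc _ _) hτ.continuous.continuousOn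
      (fun t _ => (hτd t).differentiableAt.differentiableWithinAt) fun t ht => ?_
    rw [(hτd t).deriv]
    exact (hτw t (interior_subset ht)).1
  have hτmem : ∀ t ∈ Icc 0 T', τ t ∈ Icc (0 : ℝ) 1 := fun t ht =>
    ⟨hτ0 ▸ hτmono h0mem ht ht.1, hτT ▸ hτmono ht ⟨hT0.le, le_rfl⟩ ht.2⟩
  set η : ℝ → ℝ := fun t => ζ (τ t) with hη
  have hηC : ContDiff ℝ ∞ η := hζ.comp hτ
  have hηd : ∀ t, deriv η t = deriv ζ (τ t) * τ' t := fun t =>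
    ((hζ.differentiable (by simp) (τ t)).hasDerivAt.comp t (hτd t)).deriv
  have hη' : ∀ t ∈ Icc 0 T', deriv η t ≤ 0 := fun t ht => by
    rw [hηd]
    exact mul_nonpos_of_nonpos_of_nonneg hζanti.deriv_nonpos (hτw t ht).1
  have hηbound : ∀ t ∈ Icc 0 T', -deriv η t ≤ c * η t ^ (1 / p) * w t := fun t ht => by
    rw [hηd, ← neg_mul]
    have h1 := hζd _ (hτmem t ht)
    have h2 : 0 ≤ -deriv ζ (τ t) := neg_nonneg.2 hζanti.deriv_nonpos
    have h3 : 0 ≤ ζ (τ t) ^ (1 / p) := Real.rpow_nonneg (hζnn _) _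
    exact mul_le_mul h1 (hτw t ht).2 (hτw t ht).1 (by positivity)
  have hηanti : AntitoneOn η (Icc 0 T') := fun s hs t ht hst => hζanti (hτmono hs ht hst)
  have hθc : Continuous fun s => -deriv η s * Real.exp (-s) := by
    have : Continuous (deriv η) := hηC.continuous_deriv (by simp)
    fun_prop
  have hp0 : 0 ≤ 1 / p := one_div_nonneg.2 hpq.nonneg
  -- Both η and w decrease, so the integrand is bounded by its coefficient at time t times e^{-s},
  -- and e^t ∫_t^{T'} e^{-s} ds ≤ 1. The nonlocal term is thus no larger than the bound for -η'.
  have hΘ : ∀ t ∈ Icc 0 T', Real.exp t * ∫ s in t..T', -deriv η s * Real.exp (-s) ≤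
      c * η t ^ (1 / p) * w t := fun t ht => by
    have hX : 0 ≤ c * η t ^ (1 / p) * w t :=
      mul_nonneg (mul_nonneg hc.le (Real.rpow_nonneg (hζnn _) _)) (hw0 t ht)
    have h1 : ∫ s in t..T', -deriv η s * Real.exp (-s) ≤
        ∫ s in t..T', c * η t ^ (1 / p) * w t * Real.exp (-s) := by
      refine intervalIntegral.integral_mono_on ht.2 (hθc.intervalIntegrable _ _)
        ((by fun_prop : Continuous fun s => c * η t ^ (1 / p) * w t *
          Real.exp (-s)).intervalIntegrable _ _) fun s hs => ?_
      have hsI : s ∈ Icc 0 T' := ⟨ht.1.trans hs.1, hs.2⟩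
      refine mul_le_mul_of_nonneg_right ((hηbound s hsI).trans ?_) (Real.exp_nonneg _)
      have e1 := hηanti ht hsI hs.1
      have e2 := hwanti ht hsI hs.1
      have e3 := hw0 s hsI
      have e4 : 0 ≤ η s := hζnn _
      have e5 : 0 ≤ η t := hζnn _
      gcongr
    have h2 : ∫ s in t..T', Real.exp (-s) = Real.exp (-t) - Real.exp (-T') := by
      rw [intervalIntegral.integral_comp_neg (fun s => Real.exp s), integral_exp]
    rw [intervalIntegral.integral_const_mul, h2] at h1
    have h3 : Real.exp t * Real.exp (-t) = 1 := by rw [← Real.exp_add]; simp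
    calc Real.exp t * ∫ s in t..T', -deriv η s * Real.exp (-s)
        ≤ Real.exp t * (c * η t ^ (1 / p) * w t * (Real.exp (-t) - Real.exp (-T'))) := by gcongr
      _ ≤ Real.exp t * (c * η t ^ (1 / p) * w t * Real.exp (-t)) := by
        gcongr
        linarith [Real.exp_nonneg (-T')]
      _ = c * η t ^ (1 / p) * w t * (Real.exp t * Real.exp (-t)) := by ring
      _ = _ := by rw [h3, mul_one]
  have hη0 : η 0 = 1 := by simp [η, hτ0, hζ0]
  have hm : ∀ t ∈ Icc 0 T', ∫ x in Metric.closedBall (0 : Space N) (R + t), φ x ≤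
      C₀ * (Real.exp t * (1 + t) ^ a) := fun t ht => by
    refine (hmass (R + t) (by linarith [ht.1])).trans ?_
    have ht0 := ht.1
    have h1 : (1 + (R + t)) ^ a ≤ (1 + R) ^ a * (1 + t) ^ a := by
      rw [← Real.mul_rpow (by linarith) (by linarith)]
      refine Real.rpow_le_rpow (by linarith) ?_ ha0
      nlinarith
    rw [hC₀, Real.exp_add]
    calc M * (Real.exp R * Real.exp t * (1 + (R + t)) ^ a)
        ≤ M * (Real.exp R * Real.exp t * ((1 + R) ^ a * (1 + t) ^ a)) := by gcongr
      _ = _ := by ring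
  have hpowc : ContinuousOn (fun t : ℝ => (1 + t) ^ a) (Icc 0 T') :=
    (Real.continuous_rpow_const ha0).comp_continuousOn (by fun_prop)
  have main := energy_inequality hμ hpq hε hφ hφ_pos hφ_eq hf hg h hs hT0 hT hηC hη0
    (fun t ht => hζ1 _ (hτge t ht)) (fun t => hζnn _) (fun t => hζle _) hη'
    -- The coefficient 2 + μ adds 1 for -η' and 1 + μ for the nonlocal term.
    (b := fun t => (2 + μ) * c * w t) (m := fun t => C₀ * (Real.exp t * (1 + t) ^ a))
    (continuousOn_const.mul hwc) (fun t ht => mul_nonneg hβ.le (hw0 t ht))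
    (continuousOn_const.mul (Real.continuous_exp.continuousOn.mul hpowc))
    (fun t ht => by
      have h1 := hηbound t ht
      have h2 := mul_le_mul_of_nonneg_left (hΘ t ht) (by linarith : 0 ≤ 1 + μ)
      linarith) hm
  have hΘ0 := hΘ 0 h0mem
  rw [Real.exp_zero, one_mul, hη0, Real.one_rpow, mul_one] at hΘ0
  have hΘnn : 0 ≤ ∫ s in (0 : ℝ)..T', -deriv η s * Real.exp (-s) :=
    intervalIntegral.integral_nonneg hT0.le fun s hs =>
      mul_nonneg (neg_nonneg.2 (hη' s hs)) (Real.exp_nonneg _)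
  set Θ₀ := ∫ s in (0 : ℝ)..T', -deriv η s * Real.exp (-s)
  have hrhs : ∫ t in (0 : ℝ)..T', ((2 + μ) * c * w t) ^ q * Real.exp (-t) *
      (C₀ * (Real.exp t * (1 + t) ^ a)) =
      ((2 + μ) * c) ^ q * C₀ * ∫ t in (0 : ℝ)..T', w t ^ q * (1 + t) ^ a := by
    rw [← intervalIntegral.integral_const_mul]
    refine intervalIntegral.integral_congr fun t ht => ?_
    rw [uIcc_of_le hT0.le] at ht
    have h3 : Real.exp (-t) * Real.exp t = 1 := by rw [← Real.exp_add]; simp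
    rw [Real.mul_rpow hβ.le (hw0 t ht)]
    linear_combination (((2 + μ) * c) ^ q * w t ^ q * C₀ * (1 + t) ^ a) * h3
  rw [hrhs] at main
  have hsmall : Θ₀ * B ≤ D / 2 := by
    have h1 : Θ₀ ≤ c * (D / (2 * c * (|B| + 1))) :=
      hΘ0.trans (mul_le_mul_of_nonneg_left hwle hc.le)
    have h2 : c * (D / (2 * c * (|B| + 1))) * (|B| + 1) = D / 2 := by field_simp
    calc Θ₀ * B ≤ Θ₀ * (|B| + 1) := by
          gcongr; linarith [le_abs_self B]
      _ ≤ c * (D / (2 * c * (|B| + 1))) * (|B| + 1) := by gcongr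
      _ = D / 2 := h2
  have hlow : ε * (D / 2) ≤ ε * (A + (1 - Θ₀) * B) := by
    refine mul_le_mul_of_nonneg_left ?_ hε.le
    linarith
  have hfin := hlow.trans main
  calc ε = 2 / D * (ε * (D / 2)) := by field_simp
    _ ≤ 2 / D * (((2 + μ) * c) ^ q * C₀ * ∫ t in (0 : ℝ)..T', w t ^ q * (1 + t) ^ a) :=
        mul_le_mul_of_nonneg_left hfin (by positivity)
    _ = _ := by ring

/-! ### Choice of the time scale and the lifespan bound. -/

/-- The lifespan estimate, for times beyond a constant. -/
theorem exists_lifespan_estimate {N : ℕ} (hN : 2 ≤ N) {R μ p : ℝ} (hR : 0 ≤ R) (hμ : 0 ≤ μ)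
    (hp : 1 < p) (hpG : p ≤ glasseyExponent (N + μ)) {φ : Space N → ℝ} (hφ : ContDiff ℝ 2 φ)
    (hφ_pos : ∀ x, 0 < φ x) (hφ_eq : ∀ x, Δ φ x = (1 + damping μ x) * φ x)
    {f : H1 N} {g : L2 N} (hf : ∀ᵐ x : Space N, R < ‖x‖ → fn f x = 0)
    (hg : ∀ᵐ x : Space N, R < ‖x‖ → g x = 0) (hfg : 0 < dataPairing (fn f) g φ) :
    ∃ T₀ : ℝ, ∃ C : ℝ, 0 < C ∧ ∀ (ε : ℝ) (T : ℝ≥0∞) (u : ℝ → H1 N), 0 < ε →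
      IsEnergySolution μ p ε f g T u → SupportedInCone R T u →
      ∀ T' : ℝ, ENNReal.ofReal T' < T → T' ≤ T₀ ∨ T' ≤ lifespanBound N μ p C ε := by
  have hpq : p.HolderConjugate (p / (p - 1)) := Real.HolderConjugate.conjExponent hp
  set q := p / (p - 1) with hq
  have hp1 : 0 < p - 1 := by linarith
  have hq1 : q - 1 = 1 / (p - 1) := by rw [hq]; field_simp; ring
  have hN' : (2 : ℝ) ≤ N := by exact_mod_cast hN
  have hn : 0 < (N : ℝ) + μ - 1 := by linarith
  obtain ⟨c, hc, C, hC, H⟩ :=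
    exists_weighted_inequality (by omega) hR hμ hpq hφ hφ_pos hφ_eq hf hg hfg
  set a : ℝ := ((N : ℝ) - 1 + μ) / 2 with ha
  have ha0 : 0 ≤ a := by rw [ha]; linarith
  by_cases hcase : p < glasseyExponent (N + μ)
  · -- subcritical case: a linear time scale
    have hlt : ((N : ℝ) + μ - 1) * (p - 1) < 2 := by
      rw [glasseyExponent] at hcase
      have : p - 1 < 2 / (N + μ - 1) := by linarith
      rw [lt_div_iff₀ hn] at this
      linarith
    set k : ℝ := (2 - (N + μ - 1) * (p - 1)) / (2 * (p - 1)) with hk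
    have hk0 : 0 < k := div_pos (by linarith) (by linarith)
    have hka : k = q - 1 - a := by
      rw [hq1, hk, ha]
      field_simp
      ring
    have hkinv : 2 * (p - 1) / (2 - (N + μ - 1) * (p - 1)) = k⁻¹ := by rw [hk, inv_div]
    have hC2 : 0 < C * 2 ^ a := by positivity
    -- Beyond this threshold w(0) = 1/T' is at most c, and 1 + t ≤ 2T' on [0, T'].
    refine ⟨max 1 c⁻¹, (C * 2 ^ a) ^ k⁻¹, by positivity, fun ε T u hε h hs T' hT => ?_⟩
    by_cases hT0 : T' ≤ max 1 c⁻¹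
    · exact Or.inl hT0
    right
    rw [not_le, max_lt_iff] at hT0
    obtain ⟨hT1, hTc⟩ := hT0
    have hTpos : 0 < T' := by linarith
    have key := H ε T u hε h hs T' hTpos hT (fun t => t / T') (fun _ => 1 / T') (fun _ => 1 / T')
      (contDiff_id.div_const _) (fun t => (hasDerivAt_id t).div_const _) (by simp)
      (fun t ht => (one_le_div hTpos).2 ht) (div_self hTpos.ne')
      (fun t _ => ⟨by positivity, le_rfl⟩) continuousOn_const antitoneOn_const
      (by
        rw [one_div]
        exact (inv_le_comm₀ hc hTpos).1 hTc.le)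
    have hint : ∫ t in (0 : ℝ)..T', (1 / T') ^ q * (1 + t) ^ a ≤ 2 ^ a * T' ^ (-k) := by
      have hcont : ContinuousOn (fun t : ℝ => (1 / T') ^ q * (1 + t) ^ a) (Icc 0 T') :=
        continuousOn_const.mul
          ((Real.continuous_rpow_const ha0).comp_continuousOn (by fun_prop))
      have h1 : ∫ t in (0 : ℝ)..T', (1 / T') ^ q * (1 + t) ^ a ≤
          ∫ _ in (0 : ℝ)..T', (1 / T') ^ q * (2 * T') ^ a := by
        refine intervalIntegral.integral_mono_on hTpos.le (hcont.intervalIntegrable_of_Icc hTpos.le)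
          (by simp) fun t ht => ?_
        have := ht.1
        have : 1 + t ≤ 2 * T' := by linarith [ht.2]
        gcongr
      refine h1.trans (le_of_eq ?_)
      rw [intervalIntegral.integral_const, smul_eq_mul, sub_zero, one_div, Real.inv_rpow hTpos.le,
        Real.mul_rpow (by norm_num) hTpos.le, ← Real.rpow_neg hTpos.le]
      have : T' ^ (-k) = T' ^ (1 : ℝ) * T' ^ (-q) * T' ^ a := by
        rw [← Real.rpow_add hTpos, ← Real.rpow_add hTpos]
        congr 1
        rw [hka]; ring
      rw [this, Real.rpow_one]
      ring
    have h2 : ε ≤ C * 2 ^ a * T' ^ (-k) := by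
      refine key.trans ?_
      rw [mul_assoc]
      gcongr
    have h3 : T' ^ k ≤ C * 2 ^ a * ε⁻¹ := by
      rw [Real.rpow_neg hTpos.le] at h2
      have hTk : 0 < T' ^ k := by positivity
      rw [← div_eq_mul_inv, le_div_iff₀ hTk] at h2
      rw [← div_eq_mul_inv, le_div_iff₀ hε]
      linarith
    have h4 := Real.rpow_le_rpow (by positivity) h3 (inv_nonneg.2 hk0.le)
    rw [← Real.rpow_mul hTpos.le, mul_inv_cancel₀ hk0.ne', Real.rpow_one,
      Real.mul_rpow hC2.le (inv_nonneg.2 hε.le), Real.inv_rpow hε.le, ← Real.rpow_neg hε.le] at h4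
    rw [lifespanBound, if_pos hcase, hkinv]
    exact h4
  · -- critical case: a logarithmic time scale
    have heq : p = glasseyExponent (N + μ) := le_antisymm hpG (not_lt.1 hcase)
    have hmul : ((N : ℝ) + μ - 1) * (p - 1) = 2 := by
      rw [heq, glasseyExponent]
      field_simp
      ring
    have haq : a = q - 1 := by
      rw [hq1, ha, eq_div_iff hp1.ne']
      linarith
    have hC2 : 0 < C * 4 ^ q := by positivity
    -- Beyond this threshold L ≥ 4/c, that is, w(0) = 4/L ≤ c.
    refine ⟨max 1 (Real.exp (4 / c)), (C * 4 ^ q) ^ (p - 1), by positivity,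
      fun ε T u hε h hs T' hT => ?_⟩
    by_cases hT0 : T' ≤ max 1 (Real.exp (4 / c))
    · exact Or.inl hT0
    right
    rw [not_le, max_lt_iff] at hT0
    obtain ⟨hT1, hTc⟩ := hT0
    have hTpos : 0 < T' := by linarith
    -- The scale is log(1 + t²)/L because log(1 + t) is not smooth on the whole line. Its speed is
    -- at most (4/L)/(1+t), and with a = q - 1 the weighted integrand becomes (4/L)^q/(1+t).
    set L : ℝ := Real.log (1 + T' ^ 2) with hL
    have hTL : T' ≤ Real.exp L := by
      rw [hL, Real.exp_log (by positivity)]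
      nlinarith
    have hLc : 4 / c ≤ L := (Real.exp_le_exp.1 (hTc.le.trans hTL))
    have hL0 : 0 < L := lt_of_lt_of_le (by positivity) hLc
    have hpos1 : ∀ t : ℝ, 1 + t ^ 2 ≠ 0 := fun t => by positivity
    have key := H ε T u hε h hs T' hTpos hT (fun t => Real.log (1 + t ^ 2) / L)
      (fun t => 2 * t / (1 + t ^ 2) / L) (fun t => 4 / L * (1 + t)⁻¹)
      (((contDiff_const.add (contDiff_id.pow 2)).log hpos1).div_const _)
      (fun t => by
        have h1 : HasDerivAt (fun t : ℝ => 1 + t ^ 2) (2 * t) t := by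
          simpa using (hasDerivAt_pow 2 t).const_add 1
        exact (h1.log (hpos1 t)).div_const L) (by simp)
      (fun t ht => (one_le_div hL0).2 (Real.log_le_log (by positivity) (by gcongr)))
      (div_self hL0.ne')
      (fun t ht => by
        have ht0 := ht.1
        refine ⟨by positivity, ?_⟩
        rw [div_mul_eq_mul_div, div_le_div_iff_of_pos_right hL0, ← div_eq_mul_inv,
          div_le_div_iff₀ (by positivity) (by linarith)]
        nlinarith [sq_nonneg (t - 1)])
      (continuousOn_const.mul (ContinuousOn.inv₀ (by fun_prop) fun t ht => by linarith [ht.1]))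
      (fun s hs t ht hst => by
        have := hs.1
        have h1 : (0 : ℝ) < 1 + s := by linarith
        simp only
        gcongr)
      (by
        rw [div_le_iff₀ hc] at hLc
        simp only [add_zero, inv_one, mul_one]
        rw [div_le_iff₀ hL0]
        linarith)
    have hint : ∫ t in (0 : ℝ)..T', (4 / L * (1 + t)⁻¹) ^ q * (1 + t) ^ a ≤
        4 ^ q * L ^ (-(q - 1)) := by
      have h1 : ∫ t in (0 : ℝ)..T', (4 / L * (1 + t)⁻¹) ^ q * (1 + t) ^ a =
          ∫ t in (0 : ℝ)..T', (4 / L) ^ q * (1 + t)⁻¹ := by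
        refine intervalIntegral.integral_congr fun t ht => ?_
        rw [uIcc_of_le hTpos.le] at ht
        have ht1 : 0 < 1 + t := by linarith [ht.1]
        rw [Real.mul_rpow (by positivity) (by positivity), Real.inv_rpow ht1.le, mul_assoc, haq,
          Real.rpow_sub ht1, Real.rpow_one]
        have := (Real.rpow_pos_of_pos ht1 q).ne'
        field_simp
      have h2 : ∫ t in (0 : ℝ)..T', (1 + t)⁻¹ = Real.log (1 + T') := by
        rw [intervalIntegral.integral_comp_add_left (fun t => t⁻¹),
          integral_inv_of_pos (by norm_num) (by linarith)]
        simp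
      rw [h1, intervalIntegral.integral_const_mul, h2]
      have h3 : Real.log (1 + T') ≤ L := Real.log_le_log (by linarith) (by nlinarith)
      have h4 : (4 / L) ^ q * L = 4 ^ q * L ^ (-(q - 1)) := by
        rw [Real.div_rpow (by norm_num) hL0.le, neg_sub, Real.rpow_sub hL0, Real.rpow_one]
        ring
      rw [← h4]
      gcongr
    have h2 : ε ≤ C * 4 ^ q * L ^ (-(q - 1)) := by
      refine key.trans ?_
      rw [mul_assoc]
      gcongr
    have hq10 : 0 < q - 1 := by rw [hq1]; positivity
    have h3 : L ^ (q - 1) ≤ C * 4 ^ q * ε⁻¹ := by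
      rw [Real.rpow_neg hL0.le] at h2
      have hLk : 0 < L ^ (q - 1) := by positivity
      rw [← div_eq_mul_inv, le_div_iff₀ hLk] at h2
      rw [← div_eq_mul_inv, le_div_iff₀ hε]
      linarith
    have h4 := Real.rpow_le_rpow (by positivity) h3 hp1.le
    rw [← Real.rpow_mul hL0.le, hq1, one_div_mul_cancel hp1.ne', Real.rpow_one,
      Real.mul_rpow hC2.le (inv_nonneg.2 hε.le), Real.inv_rpow hε.le, ← Real.rpow_neg hε.le] at h4
    rw [lifespanBound, if_neg hcase]
    exact hTL.trans (Real.exp_le_exp.2 h4)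

/-- For ε ≤ 1 the powers of ε in the bound are at least 1, so the bound dominates its own constant.
This absorbs the exceptional times T' ≤ T₀. -/
theorem le_lifespanBound {N : ℕ} {μ p C ε : ℝ} (hN : 2 ≤ N) (hμ : 0 ≤ μ) (hp : 1 < p) (hC : 0 ≤ C)
    (hε : 0 < ε) (hε1 : ε ≤ 1) : C ≤ lifespanBound N μ p C ε := by
  have hN' : (2 : ℝ) ≤ N := by exact_mod_cast hN
  have hp1 : 0 < p - 1 := by linarith
  have hpow : ∀ {y : ℝ}, 0 ≤ y → C ≤ C * ε ^ (-y) := fun hy =>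
    le_mul_of_one_le_right hC (Real.one_le_rpow_of_pos_of_le_one_of_nonpos hε hε1 (by linarith))
  rw [lifespanBound]
  split_ifs with h
  · refine hpow (div_nonneg (by linarith) ?_)
    have hn : 0 < (N : ℝ) + μ - 1 := by linarith
    rw [glasseyExponent] at h
    have : p - 1 < 2 / (N + μ - 1) := by linarith
    rw [lt_div_iff₀ hn] at this
    linarith
  · refine (hpow hp1.le).trans ?_
    have := Real.add_one_le_exp (C * ε ^ (-(p - 1)))
    linarith

theorem lifespanBound_mono {N : ℕ} {μ p C C' ε : ℝ} (hε : 0 < ε) (h : C ≤ C') :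
    lifespanBound N μ p C ε ≤ lifespanBound N μ p C' ε := by
  rw [lifespanBound, lifespanBound]
  split_ifs
  · gcongr
  · gcongr

end DampedWave

theorem theorem1 (N : ℕ) (hN : 2 ≤ N) (R : ℝ) (hR : 0 < R) (μ : ℝ) (hμ : 0 ≤ μ)
    (p : ℝ) (hp : 1 < p) (hpG : p ≤ glasseyExponent (N + μ))
    (φ : Space N → ℝ) (hφ : ContDiff ℝ 2 φ) (hφ_pos : ∀ x, 0 < φ x)
    (hφ_eq : ∀ x, Δ φ x = (1 + damping μ x) * φ x)
    (f : H1 N) (g : L2 N)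
    (hf : ∀ᵐ x : Space N, R < ‖x‖ → fn f x = 0)
    (hg : ∀ᵐ x : Space N, R < ‖x‖ → g x = 0)
    (hfg : 0 < dataPairing (fn f) g φ) :
    (∀ ε : ℝ, 0 < ε → ∀ u : ℝ → H1 N,
      IsEnergySolution μ p ε f g ⊤ u → ¬ SupportedInCone R ⊤ u) ∧
    ∃ ε₀ : ℝ, 0 < ε₀ ∧ ∃ C : ℝ, 0 < C ∧ ∀ ε : ℝ, 0 < ε → ε ≤ ε₀ →
      (∀ (T : ℝ≥0∞) (u : ℝ → H1 N),
        IsEnergySolution μ p ε f g T u → SupportedInCone R T u →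
          T ≤ ENNReal.ofReal (lifespanBound N μ p C ε)) ∧
      (∀ u : ℝ → H1 N,
        IsEnergySolution μ p ε f g (lifespan μ p ε f g) u →
        SupportedInCone R (lifespan μ p ε f g) u →
          lifespan μ p ε f g ≤ ENNReal.ofReal (lifespanBound N μ p C ε)) := by
  have hR0 : 0 ≤ R := hR.le
  obtain ⟨T₀, C, hC, H⟩ :=
    exists_lifespan_estimate hN hR0 hμ hp hpG hφ hφ_pos hφ_eq hf hg hfg
  refine ⟨fun ε hε u h hs => ?_, 1, one_pos, max C T₀, lt_max_of_lt_left hC, fun ε hε hε1 => ?_⟩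
  · have h1 := le_max_left T₀ (lifespanBound N μ p C ε)
    have h2 := le_max_right T₀ (lifespanBound N μ p C ε)
    -- On an infinite interval T' is arbitrary, so a value exceeding both alternatives is
    -- contradictory.
    rcases H ε ⊤ u hε h hs (max T₀ (lifespanBound N μ p C ε) + 1) ENNReal.ofReal_lt_top with h | h
    · linarith
    · linarith
  · have main : ∀ (T : ℝ≥0∞) (u : ℝ → H1 N), IsEnergySolution μ p ε f g T u →
        SupportedInCone R T u → T ≤ ENNReal.ofReal (lifespanBound N μ p (max C T₀) ε) := by
      intro T u h hs
      -- The estimate concerns finite times strictly below T. An intermediate time above t also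
      -- gives the strict inequality needed at t, and T = ∞ is covered.
      refine le_of_forall_lt fun t ht => ?_
      obtain ⟨t', htt', ht'T⟩ := exists_between ht
      have ht' : t' = ENNReal.ofReal t'.toReal := (ENNReal.ofReal_toReal ht'T.ne_top).symm
      refine htt'.trans_le ?_
      rw [ht']
      refine ENNReal.ofReal_le_ofReal ?_
      rcases H ε T u hε h hs t'.toReal (ht' ▸ ht'T) with h | h
      · exact (h.trans (le_max_right _ _)).trans
          (le_lifespanBound hN hμ hp (hC.le.trans (le_max_left _ _)) hε hε1)
      · exact h.trans (lifespanBound_mono hε (le_max_left _ _))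
    exact ⟨main, fun u => main _ u⟩
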